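/- Let $n\in\mathbb N$, let $\Omega\subset\mathbb R^n$ be open, $s\in(0,1)$, and let $q:\Omega\to[1,\infty)$ and $p:\Omega\times\Omega\to[1,\infty)$ be measurable with $1<\operatorname{ess\,inf} q\le\operatorname{ess\,sup} q<\infty$ and $1<\operatorname{ess\,inf} p\le\operatorname{ess\,sup} p<\infty$. For measurable $u:\Omega\to\mathbb R$ put $$\rho(u)=\int_\Omega|u(x)|^{q(x)}\,dx+\int_\Omega\int_\Omega\frac{|u(x)-u(y)|^{p(x,y)}}{|x-y|^{n+sp(x,y)}}\,dx\,dy .$$ Let $\mathcal W^{s,q(\cdot),p(\cdot,\cdot)}(\Omega)$ be the space of (a.e. classes of) $u\in L^{q(\cdot)}(\Omega)$ with $(x,y)\mapsto |u(x)-u(y)|\,|x-y|^{-s-n/p(x,y)}$ in $L^{p(\cdot,\cdot)}(\Omega\times\Omega)$, normed by the sum of the Luxemburg norms of these two functions, and let $\widetilde{\mathcal W}^{s,q(\cdot),p(\cdot,\cdot)}(\Omega)$ be the closure in it of $\mathcal W^{s,q(\cdot),p(\cdot,\cdot)}(\Omega)\cap C_c(\overline\Omega)$, where $C_c(\overline\Omega)$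 denotes the continuous functions on $\overline\Omega$ with compact support in $\overline\Omega$. For $O$ relatively open in $\overline\Omega$ let $$C(O)=\inf\{\rho(u): u\in\widetilde{\mathcal W}^{s,q(\cdot),p(\cdot,\cdot)}(\Omega),\ u\ge 1\text{ a.e. on }O\cap\Omega\}\in[0,\infty],$$ and for arbitrary $E\subset\overline\Omega$ let $C(E)=\inf\{C(O): O\supset E,\ O\text{ relatively open in }\overline\Omega\}$. A property holds relatively quasi-everywhere (r.q.e.) in $\Omega$ if it holds on $\Omega\setminus P$ for some $P\subset\Omega$ with $C(P)=0$. A function $v:\Omega\to\mathbb R$ is relatively quasicontinuous if for every $\varepsilon>0$ there is a relatively open $O\subset\Omega$ with $C(O)<\varepsilon$ such that $v|_{\Omega\setminus O}$ is continuous. \textbf{Theorem.} Let $(u_i)$ be a Cauchy sequence in $\widetilde{\mathcal W}^{s,q(\cdot),p(\cdot,\cdot)}(\Omega)$ with respect to the norm of $\mathcal W^{s,q(\cdot),p(\cdot,\cdot)}(\Omega)$. Then every $u_i$ has a relatively quasicontinuous representative, and there is a subsequence $(u_{i_k})$ such that, for any choice of relatively quasicontinuous representatives $v_i$ of the $u_i$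 (in particular $v_i=u_i|_\Omega$ if the $u_i$ are continuous), there is a function $w:\Omega\to\mathbb R$ with $v_{i_k}\to w$ r.q.e. in $\Omega$; moreover, for every $\varepsilon>0$ there is a set $G\subset\Omega$ with $C(G)<\varepsilon$ such that $v_{i_k}\to w$ uniformly on $\Omega\setminus G$. -/

import Mathlib

open MeasureTheory Filter Topology Set
open scoped ENNReal

noncomputable section

namespace FracVarExp

/-! ### Variable exponent Lebesgue spaces -/

section Lebesgue

variable {X : Type*} [MeasurableSpace X]

/-- `r : A → [1, ∞)` is a measurable exponent on `A` with `1 < ess inf r` and `ess sup r < ∞`.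
Functions on `A` are given by functions on the whole space of which only the values on `A`
matter. -/
structure IsVarExponent (μ : Measure X) (A : Set X) (r : X → ℝ) : Prop where
  aemeasurable : AEMeasurable r (μ.restrict A)
  one_le : ∀ x ∈ A, 1 ≤ r x
  one_lt_essInf : ∃ a : ℝ, 1 < a ∧ ∀ᵐ x ∂(μ.restrict A), a ≤ r x
  essSup_lt_top : ∃ b : ℝ, ∀ᵐ x ∂(μ.restrict A), r x ≤ b

/-- The modular `∫_A |f(x)|^{r(x)} dμ(x)`. -/
def modular (μ : Measure X) (A : Set X) (r f : X → ℝ) : ℝ≥0∞ :=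
  ∫⁻ x in A, ENNReal.ofReal (|f x| ^ r x) ∂μ

/-- `f ∈ L^{r(.)}(A)`. -/
def MemLvar (μ : Measure X) (A : Set X) (r f : X → ℝ) : Prop :=
  AEMeasurable f (μ.restrict A) ∧
    ∃ c : ℝ, 0 < c ∧ modular μ A r (fun x => c * f x) < ∞

/-- The Luxemburg norm on `L^{r(.)}(A)`. -/
def luxNorm (μ : Measure X) (A : Set X) (r f : X → ℝ) : ℝ :=
  sInf {c : ℝ | 0 < c ∧ modular μ A r (fun x => f x / c) ≤ 1}

end Lebesgue

variable {n : ℕ}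

/-! ### Fractional Sobolev spaces with variable exponents -/

/-- The quotient `|u(x) - u(y)| / |x - y|^{s + n / p(x,y)}`. -/
def gagQuot (s : ℝ) (p : EuclideanSpace ℝ (Fin n) × EuclideanSpace ℝ (Fin n) → ℝ)
    (u : EuclideanSpace ℝ (Fin n) → ℝ)
    (z : EuclideanSpace ℝ (Fin n) × EuclideanSpace ℝ (Fin n)) : ℝ :=
  |u z.1 - u z.2| / ‖z.1 - z.2‖ ^ (s + n / p z)

/-- The modular of `gagQuot s p u` has the integrand `|u(x) - u(y)|^p / |x - y|^{n + s p}`. -/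
theorem abs_gagQuot_rpow (s : ℝ)
    (p : EuclideanSpace ℝ (Fin n) × EuclideanSpace ℝ (Fin n) → ℝ)
    (u : EuclideanSpace ℝ (Fin n) → ℝ)
    (z : EuclideanSpace ℝ (Fin n) × EuclideanSpace ℝ (Fin n)) (hp : 0 < p z) :
    |gagQuot s p u z| ^ p z = |u z.1 - u z.2| ^ p z / ‖z.1 - z.2‖ ^ (n + s * p z) := by
  have h0 : (0 : ℝ) ≤ ‖z.1 - z.2‖ := norm_nonneg _
  have hq : 0 ≤ gagQuot s p u z := div_nonneg (abs_nonneg _) (Real.rpow_nonneg h0 _)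
  rw [abs_of_nonneg hq, gagQuot, Real.div_rpow (abs_nonneg _) (Real.rpow_nonneg h0 _),
    ← Real.rpow_mul h0]
  congr 2
  field_simp
  ring

/-- `u ∈ W^{s,q(.),p(.,.)}(Ω)`. -/
def MemW (s : ℝ) (Ω : Set (EuclideanSpace ℝ (Fin n))) (q : EuclideanSpace ℝ (Fin n) → ℝ)
    (p : EuclideanSpace ℝ (Fin n) × EuclideanSpace ℝ (Fin n) → ℝ)
    (u : EuclideanSpace ℝ (Fin n) → ℝ) : Prop :=
  MemLvar volume Ω q u ∧ MemLvar volume (Ω ×ˢ Ω) p (gagQuot s p u)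

/-- The modular
`∫_Ω |u(x)|^{q(x)} dx + ∫_Ω ∫_Ω |u(x) - u(y)|^{p(x,y)} / |x - y|^{n + s p(x,y)} dx dy`. -/
def rho (s : ℝ) (Ω : Set (EuclideanSpace ℝ (Fin n))) (q : EuclideanSpace ℝ (Fin n) → ℝ)
    (p : EuclideanSpace ℝ (Fin n) × EuclideanSpace ℝ (Fin n) → ℝ)
    (u : EuclideanSpace ℝ (Fin n) → ℝ) : ℝ≥0∞ :=
  modular volume Ω q u + modular volume (Ω ×ˢ Ω) p (gagQuot s p u)

/-- The norm of `W^{s,q(.),p(.,.)}(Ω)`: the Luxemburg norm in `L^{q(.)}(Ω)` plus the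
Gagliardo seminorm. -/
def normW (s : ℝ) (Ω : Set (EuclideanSpace ℝ (Fin n))) (q : EuclideanSpace ℝ (Fin n) → ℝ)
    (p : EuclideanSpace ℝ (Fin n) × EuclideanSpace ℝ (Fin n) → ℝ)
    (u : EuclideanSpace ℝ (Fin n) → ℝ) : ℝ :=
  luxNorm volume Ω q u + luxNorm volume (Ω ×ˢ Ω) p (gagQuot s p u)

/-- `u` is a continuous function on the closure of `Ω` with compact support in it. -/
def IsCc (Ω : Set (EuclideanSpace ℝ (Fin n))) (u : EuclideanSpace ℝ (Fin n) → ℝ) : Prop :=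
  ContinuousOn u (closure Ω) ∧
    ∃ K : Set (EuclideanSpace ℝ (Fin n)), IsCompact K ∧ K ⊆ closure Ω ∧
      ∀ x ∈ closure Ω \ K, u x = 0

/-- `u` belongs to the closure of `W^{s,q(.),p(.,.)}(Ω) ∩ C_c(closure Ω)` in
`W^{s,q(.),p(.,.)}(Ω)`. -/
def MemWtilde (s : ℝ) (Ω : Set (EuclideanSpace ℝ (Fin n)))
    (q : EuclideanSpace ℝ (Fin n) → ℝ)
    (p : EuclideanSpace ℝ (Fin n) × EuclideanSpace ℝ (Fin n) → ℝ)
    (u : EuclideanSpace ℝ (Fin n) → ℝ) : Prop :=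
  MemW s Ω q p u ∧
    ∀ ε : ℝ, 0 < ε → ∃ g : EuclideanSpace ℝ (Fin n) → ℝ,
      MemW s Ω q p g ∧ IsCc Ω g ∧ normW s Ω q p (fun x => u x - g x) < ε

/-! ### Relative capacity and quasicontinuity -/

/-- `O` is relatively open in the closure of `Ω`. -/
def IsRelOpen (Ω O : Set (EuclideanSpace ℝ (Fin n))) : Prop :=
  ∃ U : Set (EuclideanSpace ℝ (Fin n)), IsOpen U ∧ O = U ∩ closure Ω

/-- Admissible functions for a relatively open set `O`. Elements of the Sobolev space are
functions on `Ω`, so `u ≥ 1` a.e. on `O` refers to the points of `O ∩ Ω`. -/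
def Admissible (s : ℝ) (Ω : Set (EuclideanSpace ℝ (Fin n)))
    (q : EuclideanSpace ℝ (Fin n) → ℝ)
    (p : EuclideanSpace ℝ (Fin n) × EuclideanSpace ℝ (Fin n) → ℝ)
    (O : Set (EuclideanSpace ℝ (Fin n))) : Set (EuclideanSpace ℝ (Fin n) → ℝ) :=
  {u | MemWtilde s Ω q p u ∧ ∀ᵐ x ∂(volume.restrict (O ∩ Ω)), 1 ≤ u x}

/-- The relative capacity of a relatively open set. -/
def capOpen (s : ℝ) (Ω : Set (EuclideanSpace ℝ (Fin n)))
    (q : EuclideanSpace ℝ (Fin n) → ℝ)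
    (p : EuclideanSpace ℝ (Fin n) × EuclideanSpace ℝ (Fin n) → ℝ)
    (O : Set (EuclideanSpace ℝ (Fin n))) : ℝ≥0∞ :=
  ⨅ u ∈ Admissible s Ω q p O, rho s Ω q p u

/-- The relative capacity of a subset `A` of the closure of `Ω`. -/
def relCap (s : ℝ) (Ω : Set (EuclideanSpace ℝ (Fin n)))
    (q : EuclideanSpace ℝ (Fin n) → ℝ)
    (p : EuclideanSpace ℝ (Fin n) × EuclideanSpace ℝ (Fin n) → ℝ)
    (A : Set (EuclideanSpace ℝ (Fin n))) : ℝ≥0∞ :=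
  ⨅ O ∈ {O : Set (EuclideanSpace ℝ (Fin n)) | IsRelOpen Ω O ∧ A ⊆ O}, capOpen s Ω q p O

/-- A property holds relatively quasi-everywhere on `A`. -/
def RQE (s : ℝ) (Ω : Set (EuclideanSpace ℝ (Fin n)))
    (q : EuclideanSpace ℝ (Fin n) → ℝ)
    (p : EuclideanSpace ℝ (Fin n) × EuclideanSpace ℝ (Fin n) → ℝ)
    (A : Set (EuclideanSpace ℝ (Fin n))) (P : EuclideanSpace ℝ (Fin n) → Prop) : Prop :=
  ∃ N ⊆ A, relCap s Ω q p N = 0 ∧ ∀ x ∈ A \ N, P x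

/-- `u` is relatively quasicontinuous on `Ω`. -/
def RelQuasicontinuous (s : ℝ) (Ω : Set (EuclideanSpace ℝ (Fin n)))
    (q : EuclideanSpace ℝ (Fin n) → ℝ)
    (p : EuclideanSpace ℝ (Fin n) × EuclideanSpace ℝ (Fin n) → ℝ)
    (u : EuclideanSpace ℝ (Fin n) → ℝ) : Prop :=
  ∀ ε : ℝ≥0∞, 0 < ε → ∃ O : Set (EuclideanSpace ℝ (Fin n)), IsRelOpen Ω O ∧ O ⊆ Ω ∧
    relCap s Ω q p O < ε ∧ ContinuousOn u (Ω \ O)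

/-- `v` is a relatively quasicontinuous representative of `u` on `Ω`. -/
def IsRQCRep (s : ℝ) (Ω : Set (EuclideanSpace ℝ (Fin n)))
    (q : EuclideanSpace ℝ (Fin n) → ℝ)
    (p : EuclideanSpace ℝ (Fin n) × EuclideanSpace ℝ (Fin n) → ℝ)
    (v u : EuclideanSpace ℝ (Fin n) → ℝ) : Prop :=
  RelQuasicontinuous s Ω q p v ∧ v =ᵐ[volume.restrict Ω] u

end FracVarExp

end

/-! Because the exponents are essentially bounded, smallness of the norm and smallness of the
modular `rho` are equivalent among functions of finite modular, and multiplying by a constant or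
adding costs only a constant factor. Everything can therefore be done with `rho`.

The core is the weak type estimate `relCap_superlevel_le`. If `v` is a quasicontinuous
representative of `u`, the set where `|c v| > 1` becomes open after adding an open set `G` of small
capacity, and the maximum of `|c u|` with a test function for `G` is admissible for that union.
Along a subsequence whose differences, scaled by `2 ^ k`, have modular at most `2⁻¹ ^ k`, the sets
where consecutive representatives differ by more than `2⁻¹ ^ k` have summable capacities. Countable
subadditivity makes a tail of these sets small, and off that tail a geometric series gives uniform
convergence. The pointwise limit does not depend on the tail, so the divergence set lies in sets of
arbitrarily small capacity.

Subadditivity (`relCap_iUnion_le`) takes the supremum of nearly optimal test functions. That it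
remains in the closed space follows from dominated convergence (`memWtilde_of_dominated`), without
reflexivity or weak compactness. Existence of representatives is the same convergence argument
applied to continuous approximants. -/

namespace FracVarExp

/-! ### Modulars and Luxemburg norms for bounded variable exponents. -/

section ModularLemmas

theorem ofReal_rpow_le_add {a x y r b : ℝ} (ha : 0 ≤ a) (hx : 0 ≤ x) (hy : 0 ≤ y)
    (h : a ≤ x + y) (hr : 0 ≤ r) (hb : r ≤ b) :
    ENNReal.ofReal (a ^ r)
      ≤ ENNReal.ofReal (2 ^ b) * (ENNReal.ofReal (x ^ r) + ENNReal.ofReal (y ^ r)) := by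
  have hx' := Real.rpow_nonneg hx r
  have hy' := Real.rpow_nonneg hy r
  rw [← ENNReal.ofReal_add hx' hy', ← ENNReal.ofReal_mul (by positivity)]
  apply ENNReal.ofReal_le_ofReal
  have hm : 0 ≤ max x y := le_max_of_le_left hx
  calc a ^ r ≤ (2 * max x y) ^ r :=
        Real.rpow_le_rpow ha (by linarith [le_max_left x y, le_max_right x y]) hr
    _ = 2 ^ r * max x y ^ r := Real.mul_rpow (by norm_num) hm
    _ ≤ 2 ^ b * (x ^ r + y ^ r) := by
        refine mul_le_mul (Real.rpow_le_rpow_of_exponent_le (by norm_num) hb) ?_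
          (Real.rpow_nonneg hm _) (by positivity)
        rcases max_choice x y with h | h <;> rw [h] <;> linarith

variable {X : Type*} [MeasurableSpace X] {μ : Measure X} {A : Set X} {r : X → ℝ}

theorem IsVarExponent.exists_bound (hr : IsVarExponent μ A r) :
    ∃ b : ℝ, 1 ≤ b ∧ ∀ᵐ x ∂(μ.restrict A), 1 ≤ r x ∧ r x ≤ b := by
  obtain ⟨a, ha, hra⟩ := hr.one_lt_essInf
  obtain ⟨b, hrb⟩ := hr.essSup_lt_top
  refine ⟨max 1 b, le_max_left _ _, ?_⟩
  filter_upwards [hra, hrb] with x h1 h2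
  exact ⟨ha.le.trans h1, h2.trans (le_max_right _ _)⟩

theorem IsVarExponent.aemeasurable_integrand (hr : IsVarExponent μ A r) {f : X → ℝ}
    (hf : AEMeasurable f (μ.restrict A)) :
    AEMeasurable (fun x => ENNReal.ofReal (|f x| ^ r x)) (μ.restrict A) :=
  ((continuous_abs.measurable.comp_aemeasurable hf).pow hr.aemeasurable).ennreal_ofReal

theorem modular_mono (hr : IsVarExponent μ A r) {f g : X → ℝ}
    (h : ∀ᵐ x ∂(μ.restrict A), |f x| ≤ |g x|) : modular μ A r f ≤ modular μ A r g := by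
  obtain ⟨b, -, hb⟩ := hr.exists_bound
  refine lintegral_mono_ae ?_
  filter_upwards [h, hb] with x hx hbx
  exact ENNReal.ofReal_le_ofReal
    (Real.rpow_le_rpow (abs_nonneg _) hx (by linarith [hbx.1]))

theorem modular_zero (hr : IsVarExponent μ A r) : modular μ A r (fun _ => 0) = 0 := by
  obtain ⟨b, -, hb⟩ := hr.exists_bound
  refine (lintegral_congr_ae ?_).trans lintegral_zero
  filter_upwards [hb] with x hx
  rw [abs_zero, Real.zero_rpow (by linarith [hx.1]), ENNReal.ofReal_zero]

/-- Contraction bound for the modular. -/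
theorem modular_const_mul_le_of_le_one (hr : IsVarExponent μ A r) {c : ℝ} (hc : 0 ≤ c)
    (hc1 : c ≤ 1) (f : X → ℝ) :
    modular μ A r (fun x => c * f x) ≤ ENNReal.ofReal c * modular μ A r f := by
  obtain ⟨b, -, hb⟩ := hr.exists_bound
  rw [modular, modular, ← lintegral_const_mul' _ _ ENNReal.ofReal_ne_top]
  refine lintegral_mono_ae ?_
  filter_upwards [hb] with x hx
  rw [← ENNReal.ofReal_mul hc, abs_mul, abs_of_nonneg hc, Real.mul_rpow hc (abs_nonneg _)]
  refine ENNReal.ofReal_le_ofReal (mul_le_mul_of_nonneg_right ?_ (by positivity))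
  rcases hc.eq_or_lt with rfl | hc0
  · rw [Real.zero_rpow (by linarith [hx.1])]
  · simpa using Real.rpow_le_rpow_of_exponent_ge hc0 hc1 hx.1

/-- Dilation bound for the modular. -/
theorem modular_const_mul_le_of_one_le {b : ℝ}
    (hb : ∀ᵐ x ∂(μ.restrict A), 1 ≤ r x ∧ r x ≤ b) {c : ℝ} (hc : 1 ≤ c) (f : X → ℝ) :
    modular μ A r (fun x => c * f x) ≤ ENNReal.ofReal (c ^ b) * modular μ A r f := by
  rw [modular, modular, ← lintegral_const_mul' _ _ ENNReal.ofReal_ne_top]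
  refine lintegral_mono_ae ?_
  have hc0 : 0 ≤ c := by linarith
  filter_upwards [hb] with x hx
  rw [← ENNReal.ofReal_mul (by positivity), abs_mul, abs_of_nonneg hc0,
    Real.mul_rpow hc0 (abs_nonneg _)]
  exact ENNReal.ofReal_le_ofReal (mul_le_mul_of_nonneg_right
    (Real.rpow_le_rpow_of_exponent_le hc hx.2) (by positivity))

theorem modular_add_le (hr : IsVarExponent μ A r) {b : ℝ}
    (hb : ∀ᵐ x ∂(μ.restrict A), 1 ≤ r x ∧ r x ≤ b) {f g : X → ℝ}
    (hf : AEMeasurable f (μ.restrict A)) :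
    modular μ A r (fun x => f x + g x)
      ≤ ENNReal.ofReal (2 ^ b) * (modular μ A r f + modular μ A r g) := by
  rw [modular, modular, modular, ← lintegral_add_left' (hr.aemeasurable_integrand hf),
    ← lintegral_const_mul' _ _ ENNReal.ofReal_ne_top]
  refine lintegral_mono_ae ?_
  filter_upwards [hb] with x hx
  exact ofReal_rpow_le_add (abs_nonneg _) (abs_nonneg _) (abs_nonneg _) (abs_add_le _ _)
    (by linarith [hx.1]) hx.2

/-- A bounded exponent makes finiteness of the modular invariant under scaling, so the auxiliary
constant in the definition can be dropped. -/
theorem memLvar_iff (hr : IsVarExponent μ A r) {f : X → ℝ} :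
    MemLvar μ A r f ↔ AEMeasurable f (μ.restrict A) ∧ modular μ A r f < ∞ := by
  refine and_congr_right fun _ => ⟨?_, fun h => ⟨1, one_pos, by simpa using h⟩⟩
  rintro ⟨c, hc, h⟩
  obtain ⟨b, -, hb⟩ := hr.exists_bound
  have hk : 1 ≤ max 1 c⁻¹ := le_max_left _ _
  refine lt_of_le_of_lt (modular_mono hr (Eventually.of_forall fun x => ?_))
    (lt_of_le_of_lt (modular_const_mul_le_of_one_le hb hk fun x => c * f x)
      (ENNReal.mul_lt_top ENNReal.ofReal_lt_top h))
  rw [← mul_assoc, abs_mul]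
  refine le_mul_of_one_le_left (abs_nonneg _) (le_trans ?_ (le_abs_self _))
  calc (1 : ℝ) = c⁻¹ * c := (inv_mul_cancel₀ hc.ne').symm
    _ ≤ max 1 c⁻¹ * c := mul_le_mul_of_nonneg_right (le_max_right _ _) hc.le

theorem luxNorm_nonneg (f : X → ℝ) : 0 ≤ luxNorm μ A r f :=
  Real.sInf_nonneg fun _ hc => hc.1.le

/-- For `c ≤ 1` and exponents at least 1, `c ^ r ≤ c`, so an admissible `c < d` bounds the modular
linearly. Finiteness of the modular is needed because the real infimum of an empty set is 0. -/
theorem modular_le_of_luxNorm_lt (hr : IsVarExponent μ A r) {f : X → ℝ}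
    (hf : modular μ A r f < ∞) {d : ℝ} (hd : d ≤ 1) (h : luxNorm μ A r f < d) :
    modular μ A r f ≤ ENNReal.ofReal d := by
  have hne : {c : ℝ | 0 < c ∧ modular μ A r (fun x => f x / c) ≤ 1}.Nonempty := by
    set M := (modular μ A r f).toReal with hM
    have hM0 : 0 ≤ M := ENNReal.toReal_nonneg
    -- The added 1 makes the divisor at least 1, so the contraction bound applies even when `M` is
    -- small.
    refine ⟨M + 1, by positivity, ?_⟩
    have h1 := modular_const_mul_le_of_le_one hr (c := (M + 1)⁻¹) (by positivity)
      (inv_le_one_of_one_le₀ (by linarith)) f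
    simp only [div_eq_inv_mul]
    refine h1.trans ?_
    rw [← ENNReal.ofReal_toReal hf.ne, ← hM, ← ENNReal.ofReal_mul (by positivity),
      ENNReal.ofReal_le_one, inv_mul_le_one₀ (by positivity)]
    linarith
  obtain ⟨c, ⟨hc0, hc⟩, hcd⟩ := exists_lt_of_csInf_lt hne h
  have h1 := modular_const_mul_le_of_le_one hr hc0.le (hcd.le.trans hd) (fun x => f x / c)
  have h2 : (fun x => c * (f x / c)) = f := by
    funext x; field_simp
  rw [h2] at h1
  calc modular μ A r f ≤ ENNReal.ofReal c * modular μ A r fun x => f x / c := h1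
    _ ≤ ENNReal.ofReal d * 1 := mul_le_mul' (ENNReal.ofReal_le_ofReal hcd.le) hc
    _ = _ := mul_one _

theorem luxNorm_le_of_modular_le {b : ℝ}
    (hb : ∀ᵐ x ∂(μ.restrict A), 1 ≤ r x ∧ r x ≤ b) {f : X → ℝ} {d : ℝ} (hd0 : 0 < d)
    (hd : d ≤ 1) (h : modular μ A r f ≤ ENNReal.ofReal (d ^ b)) : luxNorm μ A r f ≤ d := by
  refine csInf_le ⟨0, fun c hc => hc.1.le⟩ ⟨hd0, ?_⟩
  have h1 := modular_const_mul_le_of_one_le hb (one_le_inv_iff₀.2 ⟨hd0, hd⟩) f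
  simp only [div_eq_inv_mul]
  refine (h1.trans (mul_le_mul_right h _)).trans ?_
  rw [← ENNReal.ofReal_mul (by positivity), Real.inv_rpow hd0.le,
    inv_mul_cancel₀ (by positivity), ENNReal.ofReal_one]

theorem tendsto_zero_of_ofReal_rpow {a : ℕ → ℝ} {t : ℝ} (ht : 0 < t)
    (h : Tendsto (fun k => ENNReal.ofReal (|a k| ^ t)) atTop (𝓝 0)) :
    Tendsto a atTop (𝓝 0) := by
  have h1 : Tendsto (fun k => |a k| ^ t) atTop (𝓝 0) := by
    have := (ENNReal.tendsto_toReal ENNReal.zero_ne_top).comp h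
    simpa [Function.comp_def, ENNReal.toReal_ofReal (Real.rpow_nonneg (abs_nonneg _) _)]
      using this
  have h2 := h1.rpow_const (p := t⁻¹) (Or.inr (by positivity))
  rw [Real.zero_rpow (by positivity)] at h2
  rw [tendsto_zero_iff_abs_tendsto_zero]
  refine h2.congr fun k => ?_
  rw [← Real.rpow_mul (abs_nonneg _), mul_inv_cancel₀ ht.ne', Real.rpow_one]
  rfl

theorem ae_tsum_ne_top_of_tsum_modular (hr : IsVarExponent μ A r) {f : ℕ → X → ℝ}
    (hf : ∀ k, AEMeasurable (f k) (μ.restrict A)) (h : ∑' k, modular μ A r (f k) ≠ ∞) :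
    ∀ᵐ x ∂(μ.restrict A), ∑' k, ENNReal.ofReal (|f k x| ^ r x) ≠ ∞ := by
  have hm := fun k => hr.aemeasurable_integrand (hf k)
  simp only [modular] at h
  rw [← lintegral_tsum hm] at h
  filter_upwards [ae_lt_top' (AEMeasurable.tsum hm) h] with x hx using hx.ne

theorem ae_tendsto_zero_of_tsum_modular (hr : IsVarExponent μ A r) {f : ℕ → X → ℝ}
    (hf : ∀ k, AEMeasurable (f k) (μ.restrict A)) (h : ∑' k, modular μ A r (f k) ≠ ∞) :
    ∀ᵐ x ∂(μ.restrict A), Tendsto (fun k => f k x) atTop (𝓝 0) := by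
  obtain ⟨b, -, hb⟩ := hr.exists_bound
  filter_upwards [ae_tsum_ne_top_of_tsum_modular hr hf h, hb] with x hx hbx
  exact tendsto_zero_of_ofReal_rpow (by linarith [hbx.1])
    (ENNReal.tendsto_atTop_zero_of_tsum_ne_top hx)

theorem ae_le_of_ae_tendsto (hr : IsVarExponent μ A r) {f : ℕ → X → ℝ} {g : X → ℝ}
    {F : X → ℝ≥0∞} (hlim : ∀ᵐ x ∂(μ.restrict A), Tendsto (fun k => f k x) atTop (𝓝 (g x)))
    (hF : ∀ k, ∀ᵐ x ∂(μ.restrict A), ENNReal.ofReal (|f k x| ^ r x) ≤ F x) :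
    ∀ᵐ x ∂(μ.restrict A), ENNReal.ofReal (|g x| ^ r x) ≤ F x := by
  obtain ⟨b, -, hb⟩ := hr.exists_bound
  filter_upwards [hlim, ae_all_iff.2 hF, hb] with x h1 h2 h3
  refine le_of_tendsto (ENNReal.tendsto_ofReal
    (h1.abs.rpow_const (Or.inr (by linarith [h3.1])))) (Eventually.of_forall h2)

/-- Dominated convergence for the modular. -/
theorem tendsto_modular_sub_of_dominated (hr : IsVarExponent μ A r) {f : ℕ → X → ℝ}
    {g : X → ℝ} {F : X → ℝ≥0∞} (hf : ∀ k, AEMeasurable (f k) (μ.restrict A))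
    (hlim : ∀ᵐ x ∂(μ.restrict A), Tendsto (fun k => f k x) atTop (𝓝 (g x)))
    (hF : ∀ k, ∀ᵐ x ∂(μ.restrict A), ENNReal.ofReal (|f k x| ^ r x) ≤ F x)
    (hFi : ∫⁻ x in A, F x ∂μ ≠ ∞) :
    Tendsto (fun k => modular μ A r (fun x => g x - f k x)) atTop (𝓝 0) := by
  obtain ⟨b, -, hb⟩ := hr.exists_bound
  have hg : AEMeasurable g (μ.restrict A) := aemeasurable_of_tendsto_metrizable_ae _ hf hlim
  have key := tendsto_lintegral_of_dominated_convergence' (μ := μ.restrict A)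
    (F := fun k x => ENNReal.ofReal (|g x - f k x| ^ r x)) (f := fun _ => 0)
    (fun x => ENNReal.ofReal (2 ^ b) * (2 * F x))
    (fun k => hr.aemeasurable_integrand (hg.sub (hf k)))
    (fun k => by
      filter_upwards [hF k, ae_le_of_ae_tendsto hr hlim hF, hb] with x h1 h2 h3
      refine (ofReal_rpow_le_add (abs_nonneg _) (abs_nonneg _) (abs_nonneg _) (abs_sub _ _)
        (by linarith [h3.1]) h3.2).trans (mul_le_mul_right ?_ _)
      rw [two_mul]
      exact add_le_add h2 h1)
    (by
      rw [lintegral_const_mul' _ _ ENNReal.ofReal_ne_top,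
        lintegral_const_mul' _ _ ENNReal.ofNat_ne_top]
      exact ENNReal.mul_ne_top ENNReal.ofReal_ne_top
        (ENNReal.mul_ne_top ENNReal.ofNat_ne_top hFi))
    (by
      filter_upwards [hlim, hb] with x h1 h2
      have h3 : Tendsto (fun k => |g x - f k x| ^ r x) atTop (𝓝 (|g x - g x| ^ r x)) :=
        (tendsto_const_nhds.sub h1).abs.rpow_const (Or.inr (by linarith [h2.1]))
      rw [sub_self, abs_zero, Real.zero_rpow (by linarith [h2.1])] at h3
      simpa using ENNReal.tendsto_ofReal h3)
  simpa [modular] using key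

/-- A rapidly converging sequence is dominated by a function with finite integral. -/
theorem exists_dominating_of_tsum_modular (hr : IsVarExponent μ A r) {f : ℕ → X → ℝ}
    {g : X → ℝ} (hf : ∀ k, AEMeasurable (f k) (μ.restrict A))
    (hg : AEMeasurable g (μ.restrict A)) (hgi : modular μ A r g ≠ ∞)
    (h : ∑' k, modular μ A r (fun x => g x - f k x) ≠ ∞) :
    ∃ F : X → ℝ≥0∞, AEMeasurable F (μ.restrict A) ∧ ∫⁻ x in A, F x ∂μ ≠ ∞ ∧
      ∀ k, ∀ᵐ x ∂(μ.restrict A), ENNReal.ofReal (|f k x| ^ r x) ≤ F x := by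
  obtain ⟨b, -, hb⟩ := hr.exists_bound
  have hgm := hr.aemeasurable_integrand hg
  have hm : ∀ k, AEMeasurable (fun x => ENNReal.ofReal (|g x - f k x| ^ r x)) (μ.restrict A) :=
    fun k => hr.aemeasurable_integrand (hg.sub (hf k))
  -- Write `f k = g - (g - f k)` and bound the single error term by the whole series of errors.
  refine ⟨fun x => ENNReal.ofReal (2 ^ b) * (ENNReal.ofReal (|g x| ^ r x)
    + ∑' k, ENNReal.ofReal (|g x - f k x| ^ r x)),
    (hgm.add (AEMeasurable.tsum hm)).const_mul _, ?_, fun k => ?_⟩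
  · rw [lintegral_const_mul' _ _ ENNReal.ofReal_ne_top, lintegral_add_left' hgm,
      lintegral_tsum hm]
    exact ENNReal.mul_ne_top ENNReal.ofReal_ne_top (ENNReal.add_ne_top.2 ⟨hgi, h⟩)
  · filter_upwards [hb] with x hx
    refine (ofReal_rpow_le_add (abs_nonneg _) (abs_nonneg (g x)) (abs_nonneg (g x - f k x)) ?_
      (by linarith [hx.1]) hx.2).trans
      (mul_le_mul_right (add_le_add_right (ENNReal.le_tsum k) _) _)
    calc |f k x| = |g x - (g x - f k x)| := by rw [sub_sub_cancel]
      _ ≤ _ := abs_sub _ _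

end ModularLemmas

/-! ### The Sobolev modular and closure under dominated convergence. -/

section SobolevModular

variable {n : ℕ} {Ω : Set (EuclideanSpace ℝ (Fin n))} {s : ℝ}
  {q : EuclideanSpace ℝ (Fin n) → ℝ}
  {p : EuclideanSpace ℝ (Fin n) × EuclideanSpace ℝ (Fin n) → ℝ}

/-- The signed version of `gagQuot`, which is linear in the function. -/
noncomputable def diffQuot (s : ℝ)
    (p : EuclideanSpace ℝ (Fin n) × EuclideanSpace ℝ (Fin n) → ℝ)
    (u : EuclideanSpace ℝ (Fin n) → ℝ)
    (z : EuclideanSpace ℝ (Fin n) × EuclideanSpace ℝ (Fin n)) : ℝ :=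
  (u z.1 - u z.2) / ‖z.1 - z.2‖ ^ (s + n / p z)

theorem abs_diffQuot (u : EuclideanSpace ℝ (Fin n) → ℝ)
    (z : EuclideanSpace ℝ (Fin n) × EuclideanSpace ℝ (Fin n)) :
    |diffQuot s p u z| = |u z.1 - u z.2| / ‖z.1 - z.2‖ ^ (s + n / p z) := by
  rw [diffQuot, abs_div, abs_of_nonneg (Real.rpow_nonneg (norm_nonneg _) _)]

theorem abs_gagQuot (u : EuclideanSpace ℝ (Fin n) → ℝ)
    (z : EuclideanSpace ℝ (Fin n) × EuclideanSpace ℝ (Fin n)) :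
    |gagQuot s p u z| = |diffQuot s p u z| := by
  rw [abs_diffQuot, gagQuot, abs_div, abs_abs,
    abs_of_nonneg (Real.rpow_nonneg (norm_nonneg _) _)]

theorem diffQuot_sub (u v : EuclideanSpace ℝ (Fin n) → ℝ) :
    diffQuot s p (fun x => u x - v x) = fun z => diffQuot s p u z - diffQuot s p v z := by
  funext z; simp only [diffQuot]; ring

theorem diffQuot_add (u v : EuclideanSpace ℝ (Fin n) → ℝ) :
    diffQuot s p (fun x => u x + v x) = fun z => diffQuot s p u z + diffQuot s p v z := by
  funext z; simp only [diffQuot]; ring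

theorem diffQuot_const_mul (c : ℝ) (u : EuclideanSpace ℝ (Fin n) → ℝ) :
    diffQuot s p (fun x => c * u x) = fun z => c * diffQuot s p u z := by
  funext z; simp only [diffQuot]; ring

theorem abs_diffQuot_le_of_le {u v : EuclideanSpace ℝ (Fin n) → ℝ}
    {z : EuclideanSpace ℝ (Fin n) × EuclideanSpace ℝ (Fin n)}
    (h : |u z.1 - u z.2| ≤ |v z.1 - v z.2|) : |diffQuot s p u z| ≤ |diffQuot s p v z| := by
  rw [abs_diffQuot, abs_diffQuot]
  exact div_le_div_of_nonneg_right h (Real.rpow_nonneg (norm_nonneg _) _)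

theorem modular_gagQuot (u : EuclideanSpace ℝ (Fin n) → ℝ) :
    modular volume (Ω ×ˢ Ω) p (gagQuot s p u) = modular volume (Ω ×ˢ Ω) p (diffQuot s p u) := by
  simp only [modular, abs_gagQuot]

theorem rho_eq (u : EuclideanSpace ℝ (Fin n) → ℝ) :
    rho s Ω q p u = modular volume Ω q u + modular volume (Ω ×ˢ Ω) p (diffQuot s p u) := by
  rw [rho, modular_gagQuot]

theorem quasiMeasurePreserving_fst_restrict :
    Measure.QuasiMeasurePreserving Prod.fst
      ((volume : Measure (EuclideanSpace ℝ (Fin n) × EuclideanSpace ℝ (Fin n))).restrict (Ω ×ˢ Ω))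
      (volume.restrict Ω) := by
  rw [Measure.volume_eq_prod, ← Measure.prod_restrict]
  exact Measure.quasiMeasurePreserving_fst

theorem quasiMeasurePreserving_snd_restrict :
    Measure.QuasiMeasurePreserving Prod.snd
      ((volume : Measure (EuclideanSpace ℝ (Fin n) × EuclideanSpace ℝ (Fin n))).restrict (Ω ×ˢ Ω))
      (volume.restrict Ω) := by
  rw [Measure.volume_eq_prod, ← Measure.prod_restrict]
  exact Measure.quasiMeasurePreserving_snd

theorem aemeasurable_diffQuot (hp : IsVarExponent volume (Ω ×ˢ Ω) p)
    {u : EuclideanSpace ℝ (Fin n) → ℝ} (hu : AEMeasurable u (volume.restrict Ω)) :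
    AEMeasurable (diffQuot s p u) (volume.restrict (Ω ×ˢ Ω)) := by
  have h1 : AEMeasurable (fun z : EuclideanSpace ℝ (Fin n) × EuclideanSpace ℝ (Fin n) => u z.1)
      (volume.restrict (Ω ×ˢ Ω)) :=
    hu.comp_quasiMeasurePreserving quasiMeasurePreserving_fst_restrict
  have h2 : AEMeasurable (fun z : EuclideanSpace ℝ (Fin n) × EuclideanSpace ℝ (Fin n) => u z.2)
      (volume.restrict (Ω ×ˢ Ω)) :=
    hu.comp_quasiMeasurePreserving quasiMeasurePreserving_snd_restrict
  refine (h1.sub h2).div (AEMeasurable.pow ?_ ((hp.aemeasurable.const_div _).const_add _))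
  exact ((continuous_fst.sub continuous_snd).norm).aemeasurable

theorem aemeasurable_gagQuot (hp : IsVarExponent volume (Ω ×ˢ Ω) p)
    {u : EuclideanSpace ℝ (Fin n) → ℝ} (hu : AEMeasurable u (volume.restrict Ω)) :
    AEMeasurable (gagQuot s p u) (volume.restrict (Ω ×ˢ Ω)) := by
  have h : gagQuot s p u = fun z => |diffQuot s p u z| := by
    funext z; rw [abs_diffQuot]; rfl
  rw [h]
  exact continuous_abs.measurable.comp_aemeasurable (aemeasurable_diffQuot hp hu)

/-- A null set in `Ω` gives null cylinders in both coordinates; this transfers pointwise convergence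
to difference quotients. -/
theorem ae_prod_of_ae {P : EuclideanSpace ℝ (Fin n) → Prop}
    (h : ∀ᵐ x ∂(volume.restrict Ω), P x) :
    ∀ᵐ z : EuclideanSpace ℝ (Fin n) × EuclideanSpace ℝ (Fin n)
      ∂(volume.restrict (Ω ×ˢ Ω)), P z.1 ∧ P z.2 :=
  (quasiMeasurePreserving_fst_restrict.ae h).and (quasiMeasurePreserving_snd_restrict.ae h)

theorem memW_iff (hq : IsVarExponent volume Ω q) (hp : IsVarExponent volume (Ω ×ˢ Ω) p)
    {u : EuclideanSpace ℝ (Fin n) → ℝ} :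
    MemW s Ω q p u ↔ AEMeasurable u (volume.restrict Ω) ∧ rho s Ω q p u < ∞ := by
  rw [MemW, memLvar_iff hq, memLvar_iff hp, rho, ENNReal.add_lt_top]
  constructor
  · rintro ⟨⟨h1, h2⟩, -, h3⟩
    exact ⟨h1, h2, h3⟩
  · rintro ⟨h1, h2, h3⟩
    exact ⟨⟨h1, h2⟩, aemeasurable_gagQuot hp h1, h3⟩

theorem exists_common_bound (hq : IsVarExponent volume Ω q)
    (hp : IsVarExponent volume (Ω ×ˢ Ω) p) :
    ∃ b : ℝ, 1 ≤ b ∧ (∀ᵐ x ∂(volume.restrict Ω), 1 ≤ q x ∧ q x ≤ b) ∧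
      ∀ᵐ z ∂(volume.restrict (Ω ×ˢ Ω)), 1 ≤ p z ∧ p z ≤ b := by
  obtain ⟨b, hb, h1⟩ := hq.exists_bound
  obtain ⟨c, -, h2⟩ := hp.exists_bound
  refine ⟨max b c, hb.trans (le_max_left _ _), ?_, ?_⟩
  · filter_upwards [h1] with x hx using ⟨hx.1, hx.2.trans (le_max_left _ _)⟩
  · filter_upwards [h2] with x hx using ⟨hx.1, hx.2.trans (le_max_right _ _)⟩

theorem rho_zero (hq : IsVarExponent volume Ω q) (hp : IsVarExponent volume (Ω ×ˢ Ω) p) :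
    rho s Ω q p (fun _ => 0) = 0 := by
  have : diffQuot s p (fun _ : EuclideanSpace ℝ (Fin n) => (0 : ℝ)) = fun _ => 0 := by
    funext z; simp [diffQuot]
  rw [rho_eq, this, modular_zero hq, modular_zero hp, add_zero]

theorem exists_rho_const_mul_le (hq : IsVarExponent volume Ω q)
    (hp : IsVarExponent volume (Ω ×ˢ Ω) p) {c : ℝ} (hc : 1 ≤ c) :
    ∃ K : ℝ≥0∞, K ≠ 0 ∧ K ≠ ∞ ∧ ∀ u : EuclideanSpace ℝ (Fin n) → ℝ,
      rho s Ω q p (fun x => c * u x) ≤ K * rho s Ω q p u := by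
  obtain ⟨b, -, hbq, hbp⟩ := exists_common_bound hq hp
  refine ⟨ENNReal.ofReal (c ^ b), by simp; positivity, ENNReal.ofReal_ne_top, fun u => ?_⟩
  rw [rho_eq, rho_eq, diffQuot_const_mul, mul_add]
  exact add_le_add (modular_const_mul_le_of_one_le hbq hc _)
    (modular_const_mul_le_of_one_le hbp hc _)

theorem exists_rho_add_le (s : ℝ) (hq : IsVarExponent volume Ω q)
    (hp : IsVarExponent volume (Ω ×ˢ Ω) p) :
    ∃ K : ℝ≥0∞, K ≠ 0 ∧ K ≠ ∞ ∧ ∀ u v : EuclideanSpace ℝ (Fin n) → ℝ,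
      AEMeasurable u (volume.restrict Ω) →
      rho s Ω q p (fun x => u x + v x) ≤ K * (rho s Ω q p u + rho s Ω q p v) := by
  obtain ⟨b, -, hbq, hbp⟩ := exists_common_bound hq hp
  refine ⟨ENNReal.ofReal (2 ^ b), by simp; positivity, ENNReal.ofReal_ne_top, fun u v hu => ?_⟩
  rw [rho_eq, rho_eq, rho_eq, diffQuot_add, add_add_add_comm, mul_add]
  exact add_le_add (modular_add_le hq hbq hu)
    (modular_add_le hp hbp (aemeasurable_diffQuot hp hu))

theorem rho_neg (u : EuclideanSpace ℝ (Fin n) → ℝ) :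
    rho s Ω q p (fun x => -u x) = rho s Ω q p u := by
  have : ∀ z, |diffQuot s p (fun x => -u x) z| = |diffQuot s p u z| := fun z => by
    rw [abs_diffQuot, abs_diffQuot, ← abs_neg]; congr 2; ring
  simp only [rho_eq, modular, abs_neg, this]

theorem exists_rho_le_of_normW_lt (hq : IsVarExponent volume Ω q)
    (hp : IsVarExponent volume (Ω ×ˢ Ω) p) {ε : ℝ≥0∞} (hε : 0 < ε) :
    ∃ d : ℝ, 0 < d ∧ ∀ u : EuclideanSpace ℝ (Fin n) → ℝ, rho s Ω q p u < ∞ →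
      normW s Ω q p u < d → rho s Ω q p u < ε := by
  obtain ⟨d, hd0, hd⟩ : ∃ d : ℝ, 0 < d ∧ ENNReal.ofReal d + ENNReal.ofReal d < ε := by
    obtain ⟨d, hd0, hd⟩ := ENNReal.lt_iff_exists_nnreal_btwn.1 (ENNReal.half_pos hε.ne')
    refine ⟨d, by simpa using hd0, ?_⟩
    rw [ENNReal.ofReal_coe_nnreal]
    calc (d : ℝ≥0∞) + d < ε / 2 + ε / 2 := ENNReal.add_lt_add hd hd
      _ = ε := ENNReal.add_halves ε
  refine ⟨min d 1, by positivity, fun u hu h => ?_⟩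
  rw [rho] at hu ⊢
  rw [ENNReal.add_lt_top] at hu
  rw [normW] at h
  have h1 := luxNorm_nonneg (μ := volume) (A := Ω) (r := q) u
  have h2 := luxNorm_nonneg (μ := volume) (A := Ω ×ˢ Ω) (r := p) (gagQuot s p u)
  refine lt_of_le_of_lt (add_le_add
    (modular_le_of_luxNorm_lt hq hu.1 (min_le_right d 1) (by linarith))
    (modular_le_of_luxNorm_lt hp hu.2 (min_le_right d 1) (by linarith))) (lt_of_le_of_lt ?_ hd)
  have := ENNReal.ofReal_le_ofReal (min_le_left d 1)
  exact add_le_add this this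

theorem exists_normW_lt_of_rho_lt (hq : IsVarExponent volume Ω q)
    (hp : IsVarExponent volume (Ω ×ˢ Ω) p) {d : ℝ} (hd : 0 < d) :
    ∃ ε : ℝ≥0∞, 0 < ε ∧ ∀ u : EuclideanSpace ℝ (Fin n) → ℝ,
      rho s Ω q p u < ε → normW s Ω q p u < d := by
  obtain ⟨b, -, hbq, hbp⟩ := exists_common_bound hq hp
  -- Each of the two Luxemburg norms will be at most `d / 3`, which leaves room for the strict
  -- inequality.
  set e := min (d / 3) 1
  have he0 : 0 < e := by positivity
  refine ⟨ENNReal.ofReal (e ^ b), by simp; positivity, fun u hu => ?_⟩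
  rw [rho] at hu
  have h1 := luxNorm_le_of_modular_le hbq he0 (min_le_right _ _)
    (le_self_add.trans hu.le : modular volume Ω q u ≤ _)
  have h2 := luxNorm_le_of_modular_le hbp he0 (min_le_right _ _)
    (le_add_self.trans hu.le : modular volume (Ω ×ˢ Ω) p (gagQuot s p u) ≤ _)
  have h3 : e ≤ d / 3 := min_le_left _ _
  rw [normW]
  linarith

theorem MemW.sub (hq : IsVarExponent volume Ω q) (hp : IsVarExponent volume (Ω ×ˢ Ω) p)
    {u v : EuclideanSpace ℝ (Fin n) → ℝ} (hu : MemW s Ω q p u) (hv : MemW s Ω q p v) :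
    MemW s Ω q p (fun x => u x - v x) := by
  rw [memW_iff hq hp] at hu hv ⊢
  obtain ⟨K, -, hK, h⟩ := exists_rho_add_le s hq hp
  refine ⟨hu.1.sub hv.1, ?_⟩
  have := h u (fun x => -v x) hu.1
  rw [rho_neg] at this
  simp only [sub_eq_add_neg]
  exact this.trans_lt (ENNReal.mul_lt_top hK.lt_top (ENNReal.add_lt_top.2 ⟨hu.2, hv.2⟩))

/-- Norm closure and modular closure coincide, so approximation can be measured by `rho` from here
on. -/
theorem memWtilde_iff (hq : IsVarExponent volume Ω q) (hp : IsVarExponent volume (Ω ×ˢ Ω) p)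
    {u : EuclideanSpace ℝ (Fin n) → ℝ} :
    MemWtilde s Ω q p u ↔ MemW s Ω q p u ∧ ∀ ε : ℝ≥0∞, 0 < ε →
      ∃ g : EuclideanSpace ℝ (Fin n) → ℝ, MemW s Ω q p g ∧ IsCc Ω g ∧
        rho s Ω q p (fun x => u x - g x) < ε := by
  refine and_congr_right fun hu => ⟨fun h ε hε => ?_, fun h d hd => ?_⟩
  · obtain ⟨d, hd, hd'⟩ := exists_rho_le_of_normW_lt (s := s) hq hp hε
    obtain ⟨g, hg, hgc, hgd⟩ := h d hd
    exact ⟨g, hg, hgc, hd' _ ((memW_iff hq hp).1 (hu.sub hq hp hg)).2 hgd⟩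
  · obtain ⟨ε, hε, hε'⟩ := exists_normW_lt_of_rho_lt (s := s) hq hp hd
    obtain ⟨g, hg, hgc, hgd⟩ := h ε hε
    exact ⟨g, hg, hgc, hε' _ hgd⟩

theorem MemW.memWtilde (hq : IsVarExponent volume Ω q) (hp : IsVarExponent volume (Ω ×ˢ Ω) p)
    {u : EuclideanSpace ℝ (Fin n) → ℝ} (hu : MemW s Ω q p u) (hc : IsCc Ω u) :
    MemWtilde s Ω q p u := by
  refine (memWtilde_iff hq hp).2 ⟨hu, fun ε hε => ⟨u, hu, hc, ?_⟩⟩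
  simpa [rho_zero hq hp] using hε

/-- The space is closed under dominated almost everywhere convergence. -/
theorem memWtilde_of_dominated (hq : IsVarExponent volume Ω q)
    (hp : IsVarExponent volume (Ω ×ˢ Ω) p) {f : ℕ → EuclideanSpace ℝ (Fin n) → ℝ}
    {g : EuclideanSpace ℝ (Fin n) → ℝ} {F : EuclideanSpace ℝ (Fin n) → ℝ≥0∞}
    {H : EuclideanSpace ℝ (Fin n) × EuclideanSpace ℝ (Fin n) → ℝ≥0∞}
    (hf : ∀ k, MemWtilde s Ω q p (f k))
    (hlim : ∀ᵐ x ∂(volume.restrict Ω), Tendsto (fun k => f k x) atTop (𝓝 (g x)))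
    (hF : ∀ k, ∀ᵐ x ∂(volume.restrict Ω), ENNReal.ofReal (|f k x| ^ q x) ≤ F x)
    (hFi : ∫⁻ x in Ω, F x ≠ ∞)
    (hH : ∀ k, ∀ᵐ z ∂(volume.restrict (Ω ×ˢ Ω)),
      ENNReal.ofReal (|diffQuot s p (f k) z| ^ p z) ≤ H z)
    (hHi : ∫⁻ z in Ω ×ˢ Ω, H z ≠ ∞) :
    MemWtilde s Ω q p g ∧ rho s Ω q p g ≤ (∫⁻ x in Ω, F x) + ∫⁻ z in Ω ×ˢ Ω, H z := by
  have hfm := fun k => ((memW_iff hq hp).1 (hf k).1).1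
  have hgm : AEMeasurable g (volume.restrict Ω) :=
    aemeasurable_of_tendsto_metrizable_ae _ hfm hlim
  have hlim' : ∀ᵐ z ∂(volume.restrict (Ω ×ˢ Ω)),
      Tendsto (fun k => diffQuot s p (f k) z) atTop (𝓝 (diffQuot s p g z)) := by
    filter_upwards [ae_prod_of_ae hlim] with z hz
    exact (hz.1.sub hz.2).div_const _
  have hrho : rho s Ω q p g ≤ (∫⁻ x in Ω, F x) + ∫⁻ z in Ω ×ˢ Ω, H z := by
    rw [rho_eq]
    exact add_le_add (lintegral_mono_ae (ae_le_of_ae_tendsto hq hlim hF))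
      (lintegral_mono_ae (ae_le_of_ae_tendsto hp hlim' hH))
  have hgW : MemW s Ω q p g := (memW_iff hq hp).2
    ⟨hgm, hrho.trans_lt (ENNReal.add_lt_top.2 ⟨hFi.lt_top, hHi.lt_top⟩)⟩
  refine ⟨(memWtilde_iff hq hp).2 ⟨hgW, fun ε hε => ?_⟩, hrho⟩
  obtain ⟨K, hK0, hK, hadd⟩ := exists_rho_add_le s hq hp
  have htend : Tendsto (fun k => rho s Ω q p (fun x => g x - f k x)) atTop (𝓝 0) := by
    simp only [rho_eq, diffQuot_sub]
    simpa using (tendsto_modular_sub_of_dominated hq hfm hlim hF hFi).add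
      (tendsto_modular_sub_of_dominated hp (fun k => aemeasurable_diffQuot hp (hfm k))
        hlim' hH hHi)
  -- The modular satisfies the triangle inequality only up to the factor `K`, which is divided out
  -- in advance.
  have hδ : 0 < ε / K / 2 := ENNReal.half_pos (ENNReal.div_pos hε.ne' hK).ne'
  obtain ⟨k, hk⟩ := (htend.eventually (gt_mem_nhds hδ)).exists
  obtain ⟨φ, hφ, hφc, hφd⟩ := ((memWtilde_iff hq hp).1 (hf k)).2 _ hδ
  refine ⟨φ, hφ, hφc, ?_⟩
  have h1 := hadd (fun x => g x - f k x) (fun x => f k x - φ x) (hgm.sub (hfm k))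
  simp only [sub_add_sub_cancel] at h1
  refine h1.trans_lt ?_
  have h2 := ENNReal.add_lt_add hk hφd
  rw [ENNReal.add_halves] at h2
  rw [mul_comm]
  exact (ENNReal.lt_div_iff_mul_lt (Or.inl hK0) (Or.inl hK)).1 h2

end SobolevModular

/-! ### Lipschitz operations, lattice operations and countable suprema. -/

section Lattice

variable {n : ℕ} {Ω : Set (EuclideanSpace ℝ (Fin n))} {s : ℝ}
  {q : EuclideanSpace ℝ (Fin n) → ℝ}
  {p : EuclideanSpace ℝ (Fin n) × EuclideanSpace ℝ (Fin n) → ℝ}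

theorem ofReal_rpow_le_mul_add {a x y r b L : ℝ} (ha : 0 ≤ a) (hx : 0 ≤ x) (hy : 0 ≤ y)
    (hL : 1 ≤ L) (h : a ≤ L * (x + y)) (hr : 0 ≤ r) (hb : r ≤ b) :
    ENNReal.ofReal (a ^ r)
      ≤ ENNReal.ofReal (L ^ b * 2 ^ b)
        * (ENNReal.ofReal (x ^ r) + ENNReal.ofReal (y ^ r)) := by
  have hL0 : 0 ≤ L := by linarith
  rw [ENNReal.ofReal_mul (by positivity), mul_assoc]
  calc ENNReal.ofReal (a ^ r) ≤ ENNReal.ofReal (L ^ b) * ENNReal.ofReal ((x + y) ^ r) := by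
        rw [← ENNReal.ofReal_mul (by positivity)]
        refine ENNReal.ofReal_le_ofReal ((Real.rpow_le_rpow ha h hr).trans ?_)
        rw [Real.mul_rpow hL0 (by positivity)]
        exact mul_le_mul_of_nonneg_right (Real.rpow_le_rpow_of_exponent_le hL hb) (by positivity)
    _ ≤ _ := mul_le_mul_right
        (ofReal_rpow_le_add (add_nonneg hx hy) hx hy le_rfl hr hb) _

theorem abs_diffQuot_comp_le {T : ℝ → ℝ → ℝ} {L : ℝ}
    (hT : ∀ a b a' b', |T a b - T a' b'| ≤ L * (|a - a'| + |b - b'|))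
    (u v : EuclideanSpace ℝ (Fin n) → ℝ)
    (z : EuclideanSpace ℝ (Fin n) × EuclideanSpace ℝ (Fin n)) :
    |diffQuot s p (fun x => T (u x) (v x)) z|
      ≤ L * (|diffQuot s p u z| + |diffQuot s p v z|) := by
  rw [abs_diffQuot, abs_diffQuot, abs_diffQuot, ← add_div, ← mul_div_assoc]
  exact div_le_div_of_nonneg_right (hT _ _ _ _) (Real.rpow_nonneg (norm_nonneg _) _)

theorem continuous_of_lipschitz {T : ℝ → ℝ → ℝ} {L : ℝ}
    (hT : ∀ a b a' b', |T a b - T a' b'| ≤ L * (|a - a'| + |b - b'|)) :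
    Continuous fun z : ℝ × ℝ => T z.1 z.2 := by
  rw [continuous_iff_continuousAt]
  intro z
  rw [ContinuousAt, tendsto_iff_dist_tendsto_zero]
  have h : Continuous fun w : ℝ × ℝ => L * (|w.1 - z.1| + |w.2 - z.2|) := by fun_prop
  refine squeeze_zero (fun _ => dist_nonneg) (fun w => ?_)
    (by simpa using h.tendsto z)
  rw [Real.dist_eq]
  exact hT _ _ _ _

/-- Summable errors supply both almost everywhere convergence and an integrable dominating function,
with no further extraction of subsequences. -/
theorem exists_approx_seq (hq : IsVarExponent volume Ω q)
    (hp : IsVarExponent volume (Ω ×ˢ Ω) p) {u : EuclideanSpace ℝ (Fin n) → ℝ}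
    (hu : MemWtilde s Ω q p u) :
    ∃ g : ℕ → EuclideanSpace ℝ (Fin n) → ℝ, (∀ k, MemW s Ω q p (g k)) ∧ (∀ k, IsCc Ω (g k)) ∧
      ∑' k, rho s Ω q p (fun x => u x - g k x) ≠ ∞ := by
  obtain ⟨ε, hε, hsum⟩ := ENNReal.exists_pos_sum_of_countable' one_ne_zero ℕ
  choose g hg hgc hgε using fun k => ((memWtilde_iff hq hp).1 hu).2 (ε k) (hε k)
  exact ⟨g, hg, hgc, ((ENNReal.tsum_le_tsum fun k => (hgε k).le).trans_lt
    (hsum.trans ENNReal.one_lt_top)).ne⟩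

theorem tsum_modular_ne_top_of_tsum_rho {w : ℕ → EuclideanSpace ℝ (Fin n) → ℝ}
    (h : ∑' k, rho s Ω q p (w k) ≠ ∞) :
    ∑' k, modular volume Ω q (w k) ≠ ∞ ∧
      ∑' k, modular volume (Ω ×ˢ Ω) p (diffQuot s p (w k)) ≠ ∞ := by
  simp only [rho_eq] at h
  rw [ENNReal.tsum_add] at h
  exact ENNReal.add_ne_top.1 h

theorem ae_tendsto_of_tsum_rho (hq : IsVarExponent volume Ω q)
    {u : EuclideanSpace ℝ (Fin n) → ℝ} {g : ℕ → EuclideanSpace ℝ (Fin n) → ℝ}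
    (hu : AEMeasurable u (volume.restrict Ω)) (hg : ∀ k, AEMeasurable (g k) (volume.restrict Ω))
    (h : ∑' k, rho s Ω q p (fun x => u x - g k x) ≠ ∞) :
    ∀ᵐ x ∂(volume.restrict Ω), Tendsto (fun k => g k x) atTop (𝓝 (u x)) := by
  filter_upwards [ae_tendsto_zero_of_tsum_modular hq (fun k => hu.sub (hg k))
    (tsum_modular_ne_top_of_tsum_rho h).1] with x hx
  simpa using (tendsto_const_nhds (x := u x)).sub hx

theorem IsCc.comp {T : ℝ → ℝ → ℝ} (hT : Continuous fun z : ℝ × ℝ => T z.1 z.2)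
    (hT0 : T 0 0 = 0) {u v : EuclideanSpace ℝ (Fin n) → ℝ} (hu : IsCc Ω u) (hv : IsCc Ω v) :
    IsCc Ω fun x => T (u x) (v x) := by
  obtain ⟨hu, K, hK, hKΩ, hK0⟩ := hu
  obtain ⟨hv, K', hK', hKΩ', hK0'⟩ := hv
  refine ⟨hT.comp_continuousOn (hu.prodMk hv), K ∪ K', hK.union hK', union_subset hKΩ hKΩ',
    fun x hx => ?_⟩
  simp only [hK0 x ⟨hx.1, fun h => hx.2 (Or.inl h)⟩, hK0' x ⟨hx.1, fun h => hx.2 (Or.inr h)⟩, hT0]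

theorem MemW.comp (hq : IsVarExponent volume Ω q) (hp : IsVarExponent volume (Ω ×ˢ Ω) p)
    {T : ℝ → ℝ → ℝ} {L : ℝ} (hL : 1 ≤ L) (hT0 : T 0 0 = 0)
    (hT : ∀ a b a' b', |T a b - T a' b'| ≤ L * (|a - a'| + |b - b'|))
    {u v : EuclideanSpace ℝ (Fin n) → ℝ} (hu : MemW s Ω q p u) (hv : MemW s Ω q p v) :
    MemW s Ω q p fun x => T (u x) (v x) := by
  obtain ⟨b, -, hbq, hbp⟩ := exists_common_bound hq hp
  rw [memW_iff hq hp] at hu hv ⊢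
  refine ⟨(continuous_of_lipschitz hT).measurable.comp_aemeasurable (hu.1.prodMk hv.1), ?_⟩
  rw [rho_eq, ENNReal.add_lt_top] at hu hv ⊢
  constructor
  · have : modular volume Ω q (fun x => T (u x) (v x)) ≤ ENNReal.ofReal (L ^ b * 2 ^ b)
        * (modular volume Ω q u + modular volume Ω q v) := by
      rw [modular, modular, modular, ← lintegral_add_left' (hq.aemeasurable_integrand hu.1),
        ← lintegral_const_mul' _ _ ENNReal.ofReal_ne_top]
      refine lintegral_mono_ae ?_
      filter_upwards [hbq] with x hx
      exact ofReal_rpow_le_mul_add (abs_nonneg _) (abs_nonneg _) (abs_nonneg _) hL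
        (by simpa [hT0] using hT (u x) (v x) 0 0) (by linarith [hx.1]) hx.2
    exact this.trans_lt (ENNReal.mul_lt_top ENNReal.ofReal_lt_top
      (ENNReal.add_lt_top.2 ⟨hu.2.1, hv.2.1⟩))
  · have : modular volume (Ω ×ˢ Ω) p (diffQuot s p fun x => T (u x) (v x))
        ≤ ENNReal.ofReal (L ^ b * 2 ^ b) * (modular volume (Ω ×ˢ Ω) p (diffQuot s p u)
          + modular volume (Ω ×ˢ Ω) p (diffQuot s p v)) := by
      rw [modular, modular, modular,
        ← lintegral_add_left' (hp.aemeasurable_integrand (aemeasurable_diffQuot hp hu.1)),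
        ← lintegral_const_mul' _ _ ENNReal.ofReal_ne_top]
      refine lintegral_mono_ae ?_
      filter_upwards [hbp] with z hz
      exact ofReal_rpow_le_mul_add (abs_nonneg _) (abs_nonneg _) (abs_nonneg _) hL
        (abs_diffQuot_comp_le hT u v z) (by linarith [hz.1]) hz.2
    exact this.trans_lt (ENNReal.mul_lt_top ENNReal.ofReal_lt_top
      (ENNReal.add_lt_top.2 ⟨hu.2.2, hv.2.2⟩))

/-- Lipschitz functions of two variables vanishing at the origin operate on the space. -/
theorem MemWtilde.comp (hq : IsVarExponent volume Ω q) (hp : IsVarExponent volume (Ω ×ˢ Ω) p)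
    {T : ℝ → ℝ → ℝ} {L : ℝ} (hL : 1 ≤ L) (hT0 : T 0 0 = 0)
    (hT : ∀ a b a' b', |T a b - T a' b'| ≤ L * (|a - a'| + |b - b'|))
    {u v : EuclideanSpace ℝ (Fin n) → ℝ} (hu : MemWtilde s Ω q p u)
    (hv : MemWtilde s Ω q p v) : MemWtilde s Ω q p fun x => T (u x) (v x) := by
  have hTc := continuous_of_lipschitz hT
  obtain ⟨b, -, hbq, hbp⟩ := exists_common_bound hq hp
  obtain ⟨g, hg, hgc, hgs⟩ := exists_approx_seq hq hp hu
  obtain ⟨h, hh, hhc, hhs⟩ := exists_approx_seq hq hp hv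
  have hum := (memW_iff hq hp).1 hu.1
  have hvm := (memW_iff hq hp).1 hv.1
  have hgm := fun k => ((memW_iff hq hp).1 (hg k)).1
  have hhm := fun k => ((memW_iff hq hp).1 (hh k)).1
  have hur := hum.2
  have hvr := hvm.2
  rw [rho_eq, ENNReal.add_lt_top] at hur hvr
  have hgs' := tsum_modular_ne_top_of_tsum_rho hgs
  have hhs' := tsum_modular_ne_top_of_tsum_rho hhs
  simp only [diffQuot_sub] at hgs' hhs'
  obtain ⟨F, hFm, hFi, hF⟩ := exists_dominating_of_tsum_modular hq hgm hum.1 hur.1.ne hgs'.1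
  obtain ⟨F', -, hFi', hF'⟩ := exists_dominating_of_tsum_modular hq hhm hvm.1 hvr.1.ne hhs'.1
  obtain ⟨H, hHm, hHi, hH⟩ := exists_dominating_of_tsum_modular hp
    (fun k => aemeasurable_diffQuot hp (hgm k)) (aemeasurable_diffQuot hp hum.1) hur.2.ne hgs'.2
  obtain ⟨H', -, hHi', hH'⟩ := exists_dominating_of_tsum_modular hp
    (fun k => aemeasurable_diffQuot hp (hhm k)) (aemeasurable_diffQuot hp hvm.1) hvr.2.ne hhs'.2
  -- Since `T 0 0 = 0`, composing the approximants with `T` keeps compact support, and the Lipschitz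
  -- bound dominates the result by the dominants of both sequences.
  refine (memWtilde_of_dominated hq hp (f := fun k x => T (g k x) (h k x))
    (F := fun x => ENNReal.ofReal (L ^ b * 2 ^ b) * (F x + F' x))
    (H := fun z => ENNReal.ofReal (L ^ b * 2 ^ b) * (H z + H' z))
    (fun k => ((hg k).comp hq hp hL hT0 hT (hh k)).memWtilde hq hp
      ((hgc k).comp hTc hT0 (hhc k))) ?_ (fun k => ?_) ?_ (fun k => ?_) ?_).1
  · filter_upwards [ae_tendsto_of_tsum_rho hq hum.1 hgm hgs,
      ae_tendsto_of_tsum_rho hq hvm.1 hhm hhs] with x h1 h2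
    exact (hTc.tendsto (u x, v x)).comp (h1.prodMk_nhds h2)
  · filter_upwards [hF k, hF' k, hbq] with x h1 h2 hx
    exact (ofReal_rpow_le_mul_add (abs_nonneg _) (abs_nonneg _) (abs_nonneg _) hL
      (by simpa [hT0] using hT (g k x) (h k x) 0 0) (by linarith [hx.1]) hx.2).trans
      (mul_le_mul_right (add_le_add h1 h2) _)
  · rw [lintegral_const_mul' _ _ ENNReal.ofReal_ne_top, lintegral_add_left' hFm]
    exact ENNReal.mul_ne_top ENNReal.ofReal_ne_top (ENNReal.add_ne_top.2 ⟨hFi, hFi'⟩)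
  · filter_upwards [hH k, hH' k, hbp] with z h1 h2 hz
    exact (ofReal_rpow_le_mul_add (abs_nonneg _) (abs_nonneg _) (abs_nonneg _) hL
      (abs_diffQuot_comp_le hT _ _ z) (by linarith [hz.1]) hz.2).trans
      (mul_le_mul_right (add_le_add h1 h2) _)
  · rw [lintegral_const_mul' _ _ ENNReal.ofReal_ne_top, lintegral_add_left' hHm]
    exact ENNReal.mul_ne_top ENNReal.ofReal_ne_top (ENNReal.add_ne_top.2 ⟨hHi, hHi'⟩)

theorem memWtilde_zero (hq : IsVarExponent volume Ω q) (hp : IsVarExponent volume (Ω ×ˢ Ω) p) :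
    MemWtilde s Ω q p fun _ => 0 := by
  refine MemW.memWtilde hq hp ((memW_iff hq hp).2 ⟨aemeasurable_const, ?_⟩)
    ⟨continuousOn_const, ∅, isCompact_empty, empty_subset _, fun _ _ => rfl⟩
  rw [rho_zero hq hp]
  exact ENNReal.zero_lt_top

theorem MemWtilde.sup (hq : IsVarExponent volume Ω q) (hp : IsVarExponent volume (Ω ×ˢ Ω) p)
    {u v : EuclideanSpace ℝ (Fin n) → ℝ} (hu : MemWtilde s Ω q p u)
    (hv : MemWtilde s Ω q p v) : MemWtilde s Ω q p fun x => max (u x) (v x) :=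
  MemWtilde.comp hq hp (T := max) le_rfl (max_self 0)
    (fun a b a' b' => by
      rw [one_mul]
      exact (abs_max_sub_max_le_max a b a' b').trans
        (max_le_add_of_nonneg (abs_nonneg _) (abs_nonneg _))) hu hv

theorem MemWtilde.sub (hq : IsVarExponent volume Ω q) (hp : IsVarExponent volume (Ω ×ˢ Ω) p)
    {u v : EuclideanSpace ℝ (Fin n) → ℝ} (hu : MemWtilde s Ω q p u)
    (hv : MemWtilde s Ω q p v) : MemWtilde s Ω q p fun x => u x - v x :=
  MemWtilde.comp hq hp (T := fun a b => a - b) le_rfl (sub_self 0)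
    (fun a b a' b' => by
      rw [one_mul, sub_sub_sub_comm]
      exact abs_sub _ _) hu hv

theorem MemWtilde.abs_const_mul (hq : IsVarExponent volume Ω q)
    (hp : IsVarExponent volume (Ω ×ˢ Ω) p) (c : ℝ) {u : EuclideanSpace ℝ (Fin n) → ℝ}
    (hu : MemWtilde s Ω q p u) : MemWtilde s Ω q p fun x => |c * u x| :=
  MemWtilde.comp hq hp (T := fun a _ => |c * a|) (L := max 1 |c|) (le_max_left _ _) (by simp)
    (fun a b a' b' => by
      refine (abs_abs_sub_abs_le_abs_sub _ _).trans ?_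
      rw [← mul_sub, abs_mul]
      exact mul_le_mul (le_max_right _ _) (le_add_of_nonneg_right (abs_nonneg _))
        (abs_nonneg _) (by positivity)) hu hu

theorem rho_abs_le (hq : IsVarExponent volume Ω q) (hp : IsVarExponent volume (Ω ×ˢ Ω) p)
    (u : EuclideanSpace ℝ (Fin n) → ℝ) : rho s Ω q p (fun x => |u x|) ≤ rho s Ω q p u := by
  rw [rho_eq, rho_eq]
  exact add_le_add (modular_mono hq (Eventually.of_forall fun x => (abs_abs _).le))
    (modular_mono hp (Eventually.of_forall fun z =>
      abs_diffQuot_le_of_le (abs_abs_sub_abs_le_abs_sub _ _)))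

/-- A difference of maxima is at most the larger of the two differences. Hence each integrand is
bounded by one of the two given ones, and no factor `2 ^ b` appears. -/
theorem rho_sup_le (hq : IsVarExponent volume Ω q) (hp : IsVarExponent volume (Ω ×ˢ Ω) p)
    {u v : EuclideanSpace ℝ (Fin n) → ℝ} (hu : AEMeasurable u (volume.restrict Ω)) :
    rho s Ω q p (fun x => max (u x) (v x)) ≤ rho s Ω q p u + rho s Ω q p v := by
  rw [rho_eq, rho_eq, rho_eq, add_add_add_comm]
  have key : ∀ {a b c t : ℝ}, (|a| ≤ |b| ∨ |a| ≤ |c|) → 0 ≤ t →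
      ENNReal.ofReal (|a| ^ t) ≤ ENNReal.ofReal (|b| ^ t) + ENNReal.ofReal (|c| ^ t) := by
    intro a b c t h ht
    rcases h with h | h
    · exact le_add_right (ENNReal.ofReal_le_ofReal (Real.rpow_le_rpow (abs_nonneg _) h ht))
    · exact le_add_left (ENNReal.ofReal_le_ofReal (Real.rpow_le_rpow (abs_nonneg _) h ht))
  obtain ⟨b, -, hbq, hbp⟩ := exists_common_bound hq hp
  refine add_le_add ?_ ?_
  · rw [modular, modular, modular, ← lintegral_add_left' (hq.aemeasurable_integrand hu)]
    refine lintegral_mono_ae ?_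
    filter_upwards [hbq] with x hx
    refine key ?_ (by linarith [hx.1])
    rcases max_choice (u x) (v x) with h | h <;> rw [h] <;> simp
  · rw [modular, modular, modular,
      ← lintegral_add_left' (hp.aemeasurable_integrand (aemeasurable_diffQuot hp hu))]
    refine lintegral_mono_ae ?_
    filter_upwards [hbp] with z hz
    refine key ?_ (by linarith [hz.1])
    rcases le_max_iff.1 (abs_max_sub_max_le_max (u z.1) (v z.1) (u z.2) (v z.2)) with h | h
    · exact Or.inl (abs_diffQuot_le_of_le h)
    · exact Or.inr (abs_diffQuot_le_of_le h)

/-- Compare both sequences at the index that realises the larger of the two partial suprema. -/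
theorem exists_abs_partialSups_sub_le (a b : ℕ → ℝ) (m : ℕ) :
    ∃ k, |partialSups a m - partialSups b m| ≤ |a k - b k| := by
  obtain ⟨i, hi, hia⟩ := exists_partialSups_eq a m
  obtain ⟨j, hj, hjb⟩ := exists_partialSups_eq b m
  have h1 : b i ≤ partialSups b m := le_partialSups_of_le b hi
  have h2 : a j ≤ partialSups a m := le_partialSups_of_le a hj
  rcases le_total (partialSups b m) (partialSups a m) with h | h
  · refine ⟨i, ?_⟩
    rw [abs_of_nonneg (by linarith)]
    exact le_trans (by linarith) (le_abs_self _)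
  · refine ⟨j, ?_⟩
    rw [abs_of_nonpos (by linarith)]
    exact le_trans (by linarith) (neg_le_abs _)

/-- Countable suprema with summable modulars stay in the space. -/
theorem memWtilde_iSup (hq : IsVarExponent volume Ω q) (hp : IsVarExponent volume (Ω ×ˢ Ω) p)
    {w : ℕ → EuclideanSpace ℝ (Fin n) → ℝ} (hw : ∀ k, MemWtilde s Ω q p (w k))
    (hs : ∑' k, rho s Ω q p (w k) ≠ ∞) :
    MemWtilde s Ω q p (fun x => ⨆ k, w k x) ∧
      rho s Ω q p (fun x => ⨆ k, w k x) ≤ ∑' k, rho s Ω q p (w k) ∧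
      ∀ᵐ x ∂(volume.restrict Ω), ∀ k, w k x ≤ ⨆ k, w k x := by
  obtain ⟨b, -, hbq, hbp⟩ := exists_common_bound hq hp
  have hwm := fun k => ((memW_iff hq hp).1 (hw k).1).1
  have hs' := tsum_modular_ne_top_of_tsum_rho hs
  -- A real supremum is meaningful only for bounded families; summability forces `w k x → 0` almost
  -- everywhere, hence boundedness.
  have hbdd : ∀ᵐ x ∂(volume.restrict Ω), BddAbove (range fun k => w k x) := by
    filter_upwards [ae_tendsto_zero_of_tsum_modular hq hwm hs'.1] with x hx
    exact hx.bddAbove_range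
  have hsup : ∀ m, MemWtilde s Ω q p fun x => partialSups (fun k => w k x) m := by
    intro m
    induction m with
    | zero => simpa using hw 0
    | succ m ih =>
      simp only [partialSups_add_one]
      exact ih.sup hq hp (hw (m + 1))
  have hq_sum : ∫⁻ x in Ω, ∑' k, ENNReal.ofReal (|w k x| ^ q x)
      = ∑' k, modular volume Ω q (w k) :=
    lintegral_tsum fun k => hq.aemeasurable_integrand (hwm k)
  have hp_sum : ∫⁻ z in Ω ×ˢ Ω, ∑' k, ENNReal.ofReal (|diffQuot s p (w k) z| ^ p z)
      = ∑' k, modular volume (Ω ×ˢ Ω) p (diffQuot s p (w k)) :=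
    lintegral_tsum fun k => hp.aemeasurable_integrand (aemeasurable_diffQuot hp (hwm k))
  have key := memWtilde_of_dominated hq hp (f := fun m x => partialSups (fun k => w k x) m)
    (g := fun x => ⨆ k, w k x) (F := fun x => ∑' k, ENNReal.ofReal (|w k x| ^ q x))
    (H := fun z => ∑' k, ENNReal.ofReal (|diffQuot s p (w k) z| ^ p z)) hsup
    (by
      filter_upwards [hbdd] with x hx
      rw [← ciSup_partialSups_eq hx]
      exact tendsto_atTop_ciSup (partialSups fun k => w k x).monotone
        (bddAbove_range_partialSups.2 hx))
    (fun m => Eventually.of_forall fun x => by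
      obtain ⟨k, -, hk⟩ := exists_partialSups_eq (fun k => w k x) m
      simp only [hk]
      exact ENNReal.le_tsum k)
    (by rw [hq_sum]; exact hs'.1)
    (fun m => by
      filter_upwards [hbp] with z hz
      obtain ⟨k, hk⟩ := exists_abs_partialSups_sub_le (fun k => w k z.1) (fun k => w k z.2) m
      refine le_trans ?_ (ENNReal.le_tsum k)
      exact ENNReal.ofReal_le_ofReal (Real.rpow_le_rpow (abs_nonneg _)
        (abs_diffQuot_le_of_le hk) (by linarith [hz.1])))
    (by rw [hp_sum]; exact hs'.2)
  refine ⟨key.1, key.2.trans ?_, ?_⟩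
  · rw [hq_sum, hp_sum, ← ENNReal.tsum_add]
    simp only [rho_eq, le_refl]
  · filter_upwards [hbdd] with x hx k using le_ciSup hx k

end Lattice

/-! ### Relative capacity, the weak type estimate and quasicontinuity. -/

section Capacity

variable {n : ℕ} {Ω : Set (EuclideanSpace ℝ (Fin n))} {s : ℝ}
  {q : EuclideanSpace ℝ (Fin n) → ℝ}
  {p : EuclideanSpace ℝ (Fin n) × EuclideanSpace ℝ (Fin n) → ℝ}

theorem relCap_le_rho {A O : Set (EuclideanSpace ℝ (Fin n))} (hO : IsRelOpen Ω O) (hAO : A ⊆ O)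
    {u : EuclideanSpace ℝ (Fin n) → ℝ} (hu : u ∈ Admissible s Ω q p O) :
    relCap s Ω q p A ≤ rho s Ω q p u :=
  (iInf₂_le O ⟨hO, hAO⟩).trans (iInf₂_le u hu)

theorem exists_admissible_of_relCap_lt {A : Set (EuclideanSpace ℝ (Fin n))} {c : ℝ≥0∞}
    (h : relCap s Ω q p A < c) :
    ∃ O, IsRelOpen Ω O ∧ A ⊆ O ∧ ∃ u ∈ Admissible s Ω q p O, rho s Ω q p u < c := by
  simp only [relCap, capOpen, iInf_lt_iff] at h
  obtain ⟨O, ⟨hO, hAO⟩, u, hu, hc⟩ := h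
  exact ⟨O, hO, hAO, u, hu, hc⟩

theorem relCap_mono {A B : Set (EuclideanSpace ℝ (Fin n))} (h : A ⊆ B) :
    relCap s Ω q p A ≤ relCap s Ω q p B :=
  biInf_mono fun _ hO => ⟨hO.1, h.trans hO.2⟩

theorem IsRelOpen.of_isOpen {O : Set (EuclideanSpace ℝ (Fin n))} (hO : IsOpen O) (h : O ⊆ Ω) :
    IsRelOpen Ω O :=
  ⟨O, hO, (inter_eq_left.2 (h.trans subset_closure)).symm⟩

theorem IsRelOpen.isOpen_inter (hΩ : IsOpen Ω) {O : Set (EuclideanSpace ℝ (Fin n))}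
    (hO : IsRelOpen Ω O) : IsOpen (O ∩ Ω) := by
  obtain ⟨U, hU, rfl⟩ := hO
  rw [inter_assoc, inter_eq_right.2 subset_closure]
  exact hU.inter hΩ

theorem IsRelOpen.iUnion {O : ℕ → Set (EuclideanSpace ℝ (Fin n))}
    (hO : ∀ k, IsRelOpen Ω (O k)) : IsRelOpen Ω (⋃ k, O k) := by
  choose U hU hOU using hO
  refine ⟨⋃ k, U k, isOpen_iUnion hU, ?_⟩
  rw [iUnion_inter]
  exact iUnion_congr hOU

theorem relCap_empty (hq : IsVarExponent volume Ω q) (hp : IsVarExponent volume (Ω ×ˢ Ω) p) :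
    relCap s Ω q p ∅ = 0 := by
  rw [← nonpos_iff_eq_zero, ← rho_zero (s := s) hq hp]
  exact relCap_le_rho (IsRelOpen.of_isOpen isOpen_empty (empty_subset _)) subset_rfl
    ⟨memWtilde_zero hq hp, by simp⟩

/-- The supremum of nearly optimal test functions is admissible for the union of their relatively
open sets, and its modular is at most the sum of theirs. -/
theorem relCap_iUnion_le (hq : IsVarExponent volume Ω q)
    (hp : IsVarExponent volume (Ω ×ˢ Ω) p) (A : ℕ → Set (EuclideanSpace ℝ (Fin n))) :
    relCap s Ω q p (⋃ k, A k) ≤ ∑' k, relCap s Ω q p (A k) := by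
  refine ENNReal.le_of_forall_pos_le_add fun ε hε hfin => ?_
  obtain ⟨δ, hδ, hsum⟩ :=
    ENNReal.exists_pos_sum_of_countable' (ENNReal.coe_pos.2 hε).ne' ℕ
  have hlt : ∀ k, relCap s Ω q p (A k) < relCap s Ω q p (A k) + δ k := fun k =>
    ENNReal.lt_add_right ((ENNReal.le_tsum k).trans_lt hfin).ne (hδ k).ne'
  choose O hO hAO w hw hwlt using fun k => exists_admissible_of_relCap_lt (hlt k)
  have hle : ∑' k, rho s Ω q p (w k) ≤ ∑' k, relCap s Ω q p (A k) + ε := by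
    refine (ENNReal.tsum_le_tsum fun k => (hwlt k).le).trans ?_
    rw [ENNReal.tsum_add]
    exact add_le_add_right hsum.le _
  obtain ⟨h1, h2, h3⟩ := memWtilde_iSup hq hp (fun k => (hw k).1)
    (hle.trans_lt (ENNReal.add_lt_top.2 ⟨hfin, ENNReal.coe_lt_top⟩)).ne
  refine (relCap_le_rho (IsRelOpen.iUnion hO) (iUnion_mono hAO) ⟨h1, ?_⟩).trans (h2.trans hle)
  rw [iUnion_inter, ae_restrict_iUnion_iff]
  intro k
  filter_upwards [(hw k).2, ae_restrict_of_ae_restrict_of_subset inter_subset_right h3]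
    with x hx hx'
  exact hx.trans (hx' k)

theorem relCap_union_le (hq : IsVarExponent volume Ω q)
    (hp : IsVarExponent volume (Ω ×ˢ Ω) p) (A B : Set (EuclideanSpace ℝ (Fin n))) :
    relCap s Ω q p (A ∪ B) ≤ relCap s Ω q p A + relCap s Ω q p B :=
  measure_union_le (μ := ({
    measureOf := relCap s Ω q p
    empty := relCap_empty hq hp
    mono := relCap_mono
    iUnion_nat := fun A _ => relCap_iUnion_le hq hp A } :
      OuterMeasure (EuclideanSpace ℝ (Fin n)))) A B

/-- A relatively open subset of the closure meets the open set `Ω` in a genuinely open set, and the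
intersection keeps the same test function. -/
theorem exists_isOpen_relCap_lt (hΩ : IsOpen Ω) {A : Set (EuclideanSpace ℝ (Fin n))}
    (hA : A ⊆ Ω) {c : ℝ≥0∞} (h : relCap s Ω q p A < c) :
    ∃ G, IsOpen G ∧ A ⊆ G ∧ G ⊆ Ω ∧ relCap s Ω q p G < c := by
  obtain ⟨O, hO, hAO, u, hu, hc⟩ := exists_admissible_of_relCap_lt h
  exact ⟨O ∩ Ω, hO.isOpen_inter hΩ, subset_inter hAO hA, inter_subset_right,
    (relCap_le_rho hO inter_subset_left hu).trans_lt hc⟩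

theorem relQuasicontinuous_of_continuousOn (hq : IsVarExponent volume Ω q)
    (hp : IsVarExponent volume (Ω ×ˢ Ω) p) {v : EuclideanSpace ℝ (Fin n) → ℝ}
    (hv : ContinuousOn v Ω) : RelQuasicontinuous s Ω q p v := fun ε hε =>
  ⟨∅, IsRelOpen.of_isOpen isOpen_empty (empty_subset _), empty_subset _,
    by rwa [relCap_empty hq hp], by rwa [sdiff_empty]⟩

theorem RelQuasicontinuous.sub (hq : IsVarExponent volume Ω q)
    (hp : IsVarExponent volume (Ω ×ˢ Ω) p) {v w : EuclideanSpace ℝ (Fin n) → ℝ}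
    (hv : RelQuasicontinuous s Ω q p v) (hw : RelQuasicontinuous s Ω q p w) :
    RelQuasicontinuous s Ω q p fun x => v x - w x := by
  intro ε hε
  obtain ⟨O, ⟨U, hU, rfl⟩, hOΩ, hOε, hOv⟩ := hv _ (ENNReal.half_pos hε.ne')
  obtain ⟨O', ⟨U', hU', rfl⟩, hOΩ', hOε', hOw⟩ := hw _ (ENNReal.half_pos hε.ne')
  refine ⟨_, ⟨U ∪ U', hU.union hU', (union_inter_distrib_right _ _ _).symm⟩,
    union_subset hOΩ hOΩ', (relCap_union_le hq hp _ _).trans_lt ?_,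
    (hOv.mono (sdiff_subset_sdiff_right subset_union_left)).sub
      (hOw.mono (sdiff_subset_sdiff_right subset_union_right))⟩
  exact (ENNReal.add_lt_add hOε hOε').trans_eq (ENNReal.add_halves ε)

/-- Capacitary weak type estimate for quasicontinuous functions. -/
theorem relCap_superlevel_le (hΩ : IsOpen Ω) (hq : IsVarExponent volume Ω q)
    (hp : IsVarExponent volume (Ω ×ˢ Ω) p) {u v : EuclideanSpace ℝ (Fin n) → ℝ}
    (hu : MemWtilde s Ω q p u) (hv : IsRQCRep s Ω q p v u) (c : ℝ) :
    relCap s Ω q p {x ∈ Ω | 1 < |c * v x|} ≤ rho s Ω q p fun x => c * u x := by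
  refine ENNReal.le_of_forall_pos_le_add fun ε hε _ => ?_
  obtain ⟨O, -, hOΩ, hOε, hOv⟩ := hv.1 ε (ENNReal.coe_pos.2 hε)
  obtain ⟨G, hG, hOG, hGΩ, hGε⟩ := exists_isOpen_relCap_lt hΩ hOΩ hOε
  obtain ⟨D, hD, hGD, w, hw, hwε⟩ := exists_admissible_of_relCap_lt hGε
  have hcont : ContinuousOn (fun x => |c * v x|) (Ω \ G) :=
    (continuousOn_const.mul (hOv.mono (sdiff_subset_sdiff_right hOG))).abs
  -- Off `G` the superlevel set is the trace of an open set `V`; adding `G` back therefore produces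
  -- an open set.
  obtain ⟨V, hV, hVeq⟩ := continuousOn_iff'.1 hcont (Ioi 1) isOpen_Ioi
  have hsub : {x ∈ Ω | 1 < |c * v x|} ∪ G = V ∩ Ω ∪ G := by
    ext x
    have hx : x ∈ (fun x => |c * v x|) ⁻¹' Ioi 1 ∩ (Ω \ G) ↔ x ∈ V ∩ (Ω \ G) := by rw [hVeq]
    simp only [mem_inter_iff, mem_preimage, mem_Ioi, Set.mem_sdiff] at hx
    simp only [mem_union, mem_ofPred_eq, mem_inter_iff]
    tauto
  have hu' := hu.abs_const_mul hq hp c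
  have hopen : IsRelOpen Ω ({x ∈ Ω | 1 < |c * v x|} ∪ G) := by
    rw [hsub]
    exact IsRelOpen.of_isOpen ((hV.inter hΩ).union hG) (union_subset inter_subset_right hGΩ)
  -- The test function is the maximum of `|c * u|`, which handles the superlevel set, and `w`, which
  -- handles `G` at cost `ε`.
  refine (relCap_le_rho hopen subset_union_left ⟨hu'.sup hq hp hw.1, ?_⟩).trans
    ((rho_sup_le hq hp ((memW_iff hq hp).1 hu'.1).1).trans
      (add_le_add (rho_abs_le hq hp _) hwε.le))
  have hm : MeasurableSet (({x ∈ Ω | 1 < |c * v x|} ∪ G) ∩ Ω) := by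
    rw [hsub]
    exact (((hV.inter hΩ).union hG).inter hΩ).measurableSet
  have h1 : ∀ᵐ x ∂(volume.restrict (({x ∈ Ω | 1 < |c * v x|} ∪ G) ∩ Ω)), v x = u x :=
    ae_restrict_of_ae_restrict_of_subset inter_subset_right hv.2
  have h2 : ∀ᵐ x ∂(volume.restrict (({x ∈ Ω | 1 < |c * v x|} ∪ G) ∩ Ω)),
      x ∈ G → 1 ≤ w x := by
    refine ae_restrict_of_ae_restrict_of_subset (t := Ω) inter_subset_right ?_
    rw [← ae_restrict_iff'₀ hG.measurableSet.nullMeasurableSet, Measure.restrict_restrict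
      hG.measurableSet]
    exact ae_restrict_of_ae_restrict_of_subset (inter_subset_inter_left _ hGD) hw.2
  filter_upwards [h1, h2, ae_restrict_mem hm] with x hx1 hx2 hx
  rcases hx.1 with h | h
  · rw [← hx1]
    exact le_max_of_le_left h.2.le
  · exact le_max_of_le_right (hx2 h)

theorem exists_subseq_fast (hq : IsVarExponent volume Ω q)
    (hp : IsVarExponent volume (Ω ×ˢ Ω) p) {u : ℕ → EuclideanSpace ℝ (Fin n) → ℝ}
    (h : ∀ ε : ℝ≥0∞, 0 < ε → ∃ N, ∀ i ≥ N, ∀ j ≥ N,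
      rho s Ω q p (fun x => u i x - u j x) < ε) :
    ∃ φ : ℕ → ℕ, StrictMono φ ∧ ∀ k,
      rho s Ω q p (fun x => 2 ^ k * (u (φ k) x - u (φ (k + 1)) x)) ≤ (2⁻¹ : ℝ≥0∞) ^ k := by
  have key : ∀ k : ℕ, ∃ N, ∀ i ≥ N, ∀ j ≥ i,
      rho s Ω q p (fun x => 2 ^ k * (u i x - u j x)) ≤ (2⁻¹ : ℝ≥0∞) ^ k := fun k => by
    -- The dilation constant `K` grows with `k`, but `k` is fixed before the Cauchy threshold is
    -- chosen.
    obtain ⟨K, hK0, hK, hle⟩ := exists_rho_const_mul_le (s := s) hq hp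
      (one_le_pow₀ one_le_two : (1 : ℝ) ≤ 2 ^ k)
    have hpos : 0 < (2⁻¹ : ℝ≥0∞) ^ k / K :=
      ENNReal.div_pos (pow_ne_zero _ (ENNReal.inv_ne_zero.2 ENNReal.ofNat_ne_top)) hK
    obtain ⟨N, hN⟩ := h _ hpos
    refine ⟨N, fun i hi j hj => (hle _).trans ?_⟩
    rw [mul_comm]
    exact (ENNReal.le_div_iff_mul_le (Or.inl hK0) (Or.inl hK)).1 (hN i hi j (hi.trans hj)).le
  obtain ⟨φ, hφ, hφ'⟩ := extraction_forall_of_eventually' key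
  exact ⟨φ, hφ, fun k => hφ' k _ (hφ.monotone k.le_succ)⟩

/-- From `j` on, consecutive terms differ by at most `2⁻¹ ^ k`. The sequence therefore converges,
`limUnder` is its actual limit, and the remaining steps sum to `2 * 2⁻¹ ^ k`. -/
theorem dist_limUnder_le_of_geometric {a : ℕ → ℝ} {j : ℕ}
    (h : ∀ k ≥ j, |2 ^ k * (a k - a (k + 1))| ≤ 1) :
    ∀ k ≥ j, dist (a k) (limUnder atTop a) ≤ 2 * 2⁻¹ ^ k := by
  have hgeo : ∀ m ≥ j, ∀ i, dist (a (m + i)) (a (m + i + 1)) ≤ 2⁻¹ ^ m * 2⁻¹ ^ i := by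
    intro m hm i
    have h1 := h (m + i) (by omega)
    rw [abs_mul, abs_of_pos (by positivity)] at h1
    rw [Real.dist_eq, ← pow_add, inv_pow, ← one_div, le_div_iff₀' (by positivity)]
    exact h1
  have hlim : Tendsto a atTop (𝓝 (limUnder atTop a)) := by
    obtain ⟨l, hl⟩ := cauchySeq_tendsto_of_complete
      (cauchySeq_of_le_geometric (f := fun i => a (j + i)) 2⁻¹ (2⁻¹ ^ j) (by norm_num)
        (hgeo j le_rfl))
    refine tendsto_nhds_limUnder ⟨l, (tendsto_add_atTop_iff_nat j).1 ?_⟩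
    simpa only [add_comm] using hl
  intro k hk
  have hl : Tendsto (fun i => a (k + i)) atTop (𝓝 (limUnder atTop a)) := by
    simpa only [add_comm] using (tendsto_add_atTop_iff_nat k).2 hlim
  have := dist_le_of_le_geometric_of_tendsto 2⁻¹ (2⁻¹ ^ k) (by norm_num) (hgeo k hk) hl 0
  rw [add_zero] at this
  refine this.trans_eq ?_
  ring

/-- Rapidly convergent sequences converge uniformly off open sets of small capacity. -/
theorem exists_isOpen_tendstoUniformlyOn (hΩ : IsOpen Ω) (hq : IsVarExponent volume Ω q)
    (hp : IsVarExponent volume (Ω ×ˢ Ω) p) {u v : ℕ → EuclideanSpace ℝ (Fin n) → ℝ}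
    (hu : ∀ k, MemWtilde s Ω q p (u k)) (hv : ∀ k, IsRQCRep s Ω q p (v k) (u k))
    (hfast : ∀ k, rho s Ω q p (fun x => 2 ^ k * (u k x - u (k + 1) x)) ≤ (2⁻¹ : ℝ≥0∞) ^ k)
    {ε : ℝ≥0∞} (hε : 0 < ε) :
    ∃ G, IsOpen G ∧ G ⊆ Ω ∧ relCap s Ω q p G < ε ∧
      TendstoUniformlyOn v (fun x => limUnder atTop fun k => v k x) atTop (Ω \ G) := by
  have hcap : ∀ k, relCap s Ω q p {x ∈ Ω | 1 < |2 ^ k * (v k x - v (k + 1) x)|}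
      ≤ (2⁻¹ : ℝ≥0∞) ^ k := fun k =>
    (relCap_superlevel_le hΩ hq hp ((hu k).sub hq hp (hu (k + 1)))
      ⟨(hv k).1.sub hq hp (hv (k + 1)).1, (hv k).2.sub (hv (k + 1)).2⟩ _).trans (hfast k)
  have hsum : ∑' k : ℕ, (2⁻¹ : ℝ≥0∞) ^ k ≠ ∞ := by
    rw [ENNReal.tsum_geometric, ENNReal.one_sub_inv_two, inv_inv]
    exact ENNReal.ofNat_ne_top
  -- The tail of the geometric series beyond `j` bounds the capacity of all later bad sets together.
  obtain ⟨j, hj⟩ :=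
    ((ENNReal.tendsto_sum_nat_add _ hsum).eventually (gt_mem_nhds hε)).exists
  obtain ⟨G, hG, hEG, hGΩ, hGε⟩ := exists_isOpen_relCap_lt hΩ
    (A := ⋃ k, {x ∈ Ω | 1 < |2 ^ (k + j) * (v (k + j) x - v (k + j + 1) x)|})
    (iUnion_subset fun k x hx => hx.1)
    ((relCap_iUnion_le hq hp _).trans_lt
      ((ENNReal.tsum_le_tsum fun k => hcap (k + j)).trans_lt hj))
  refine ⟨G, hG, hGΩ, hGε, Metric.tendstoUniformlyOn_iff.2 fun δ hδ => ?_⟩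
  have hgeo : Tendsto (fun k : ℕ => (2 : ℝ) * 2⁻¹ ^ k) atTop (𝓝 0) := by
    simpa using (tendsto_pow_atTop_nhds_zero_of_lt_one (r := (2⁻¹ : ℝ)) (by norm_num)
      (by norm_num)).const_mul 2
  filter_upwards [hgeo.eventually (gt_mem_nhds hδ), eventually_ge_atTop j] with k hk hkj x hx
  rw [dist_comm]
  refine (dist_limUnder_le_of_geometric (a := fun k => v k x) (j := j) (fun i hi => ?_)
    k hkj).trans_lt hk
  by_contra! hlt
  refine hx.2 (hEG (mem_iUnion.2 ⟨i - j, hx.1, ?_⟩))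
  rwa [Nat.sub_add_cancel hi]

/-- Continuous approximants converge uniformly off open sets of small capacity, so their limit is
continuous there; summable errors identify it with `u` almost everywhere. -/
theorem exists_isRQCRep (hΩ : IsOpen Ω) (hq : IsVarExponent volume Ω q)
    (hp : IsVarExponent volume (Ω ×ˢ Ω) p) {u : EuclideanSpace ℝ (Fin n) → ℝ}
    (hu : MemWtilde s Ω q p u) : ∃ v, IsRQCRep s Ω q p v u := by
  obtain ⟨g, hg, hgc, hgs⟩ := exists_approx_seq hq hp hu
  have hgm := fun k => ((memW_iff hq hp).1 (hg k)).1
  have hum := ((memW_iff hq hp).1 hu.1).1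
  have hlim := ae_tendsto_of_tsum_rho hq hum hgm hgs
  obtain ⟨K, hK0, hK, hadd⟩ := exists_rho_add_le s hq hp
  have hcau : ∀ ε : ℝ≥0∞, 0 < ε → ∃ N, ∀ i ≥ N, ∀ j ≥ N,
      rho s Ω q p (fun x => g i x - g j x) < ε := fun ε hε => by
    have hδ : 0 < ε / K / 2 := ENNReal.half_pos (ENNReal.div_pos hε.ne' hK).ne'
    obtain ⟨N, hN⟩ := eventually_atTop.1
      ((ENNReal.tendsto_atTop_zero_of_tsum_ne_top hgs).eventually (gt_mem_nhds hδ))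
    refine ⟨N, fun i hi j hj => ?_⟩
    -- Passing through `u` bounds the difference of two approximants by their separate errors.
    have h1 := hadd (fun x => u x - g j x) (fun x => -(u x - g i x)) (hum.sub (hgm j))
    rw [rho_neg] at h1
    have h2 : (fun x => u x - g j x + -(u x - g i x)) = fun x => g i x - g j x := by
      funext x; ring
    rw [h2] at h1
    have h3 := ENNReal.add_lt_add (hN j hj) (hN i hi)
    rw [ENNReal.add_halves] at h3
    refine h1.trans_lt ?_
    rw [mul_comm]
    exact (ENNReal.lt_div_iff_mul_lt (Or.inl hK0) (Or.inl hK)).1 h3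
  obtain ⟨φ, hφ, hfast⟩ := exists_subseq_fast hq hp hcau
  have hc : ∀ k, ContinuousOn (g k) Ω := fun k => (hgc k).1.mono subset_closure
  refine ⟨fun x => limUnder atTop fun k => g (φ k) x, fun ε hε => ?_, ?_⟩
  · obtain ⟨G, hG, hGΩ, hGε, hunif⟩ := exists_isOpen_tendstoUniformlyOn hΩ hq hp
      (u := fun k => g (φ k)) (v := fun k => g (φ k))
      (fun k => (hg _).memWtilde hq hp (hgc _))
      (fun k => ⟨relQuasicontinuous_of_continuousOn hq hp (hc _), EventuallyEq.rfl⟩) hfast hε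
    exact ⟨G, IsRelOpen.of_isOpen hG hGΩ, hGΩ, hGε,
      hunif.continuousOn (Eventually.of_forall fun k => (hc _).mono sdiff_subset).frequently⟩
  · filter_upwards [hlim] with x hx
    exact (hx.comp hφ.tendsto_atTop).limUnder_eq

end Capacity

end FracVarExp

/-! ### The convergence theorem. -/

theorem mainTheorem10 (n : ℕ) (Ω : Set (EuclideanSpace ℝ (Fin n))) (hΩ : IsOpen Ω)
    (s : ℝ) (hs0 : 0 < s) (hs1 : s < 1)
    (q : EuclideanSpace ℝ (Fin n) → ℝ) (hq : FracVarExp.IsVarExponent volume Ω q)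
    (p : EuclideanSpace ℝ (Fin n) × EuclideanSpace ℝ (Fin n) → ℝ)
    (hp : FracVarExp.IsVarExponent volume (Ω ×ˢ Ω) p)
    (u : ℕ → EuclideanSpace ℝ (Fin n) → ℝ)
    (hu : ∀ i, FracVarExp.MemWtilde s Ω q p (u i))
    (hcauchy : ∀ ε : ℝ, 0 < ε → ∃ N : ℕ, ∀ i ≥ N, ∀ j ≥ N,
      FracVarExp.normW s Ω q p (fun x => u i x - u j x) < ε) :
    (∀ i, ∃ v : EuclideanSpace ℝ (Fin n) → ℝ, FracVarExp.IsRQCRep s Ω q p v (u i)) ∧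
    ∃ φ : ℕ → ℕ, StrictMono φ ∧
      ∀ v : ℕ → EuclideanSpace ℝ (Fin n) → ℝ,
        (∀ i, FracVarExp.IsRQCRep s Ω q p (v i) (u i)) →
        ∃ w : EuclideanSpace ℝ (Fin n) → ℝ,
          FracVarExp.RQE s Ω q p Ω
            (fun x => Tendsto (fun k => v (φ k) x) atTop (𝓝 (w x))) ∧
          ∀ ε : ℝ≥0∞, 0 < ε → ∃ G ⊆ Ω, FracVarExp.relCap s Ω q p G < ε ∧
            TendstoUniformlyOn (fun k => v (φ k)) w atTop (Ω \ G) := by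
  refine ⟨fun i => FracVarExp.exists_isRQCRep hΩ hq hp (hu i), ?_⟩
  -- Fast convergence concerns the modulars of the `u i` alone, so the subsequence is fixed before
  -- any representatives are chosen.
  obtain ⟨φ, hφ, hfast⟩ := FracVarExp.exists_subseq_fast (s := s) hq hp (u := u) fun ε hε => by
    obtain ⟨d, hd, hd'⟩ := FracVarExp.exists_rho_le_of_normW_lt (s := s) hq hp hε
    obtain ⟨N, hN⟩ := hcauchy d hd
    exact ⟨N, fun i hi j hj => hd' _
      ((FracVarExp.memW_iff hq hp).1 ((hu i).1.sub hq hp (hu j).1)).2 (hN i hi j hj)⟩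
  refine ⟨φ, hφ, fun v hv => ?_⟩
  have key := fun (ε : ℝ≥0∞) (hε : 0 < ε) =>
    FracVarExp.exists_isOpen_tendstoUniformlyOn hΩ hq hp (fun k => hu (φ k))
      (fun k => hv (φ k)) hfast hε
  -- Defining the limit pointwise makes it independent of `ε`, so one function serves every
  -- exceptional set.
  refine ⟨fun x => limUnder atTop fun k => v (φ k) x,
    ⟨{x ∈ Ω | ¬ Tendsto (fun k => v (φ k) x) atTop (𝓝 (limUnder atTop fun k => v (φ k) x))},
      fun x hx => hx.1, ?_, fun x hx => ?_⟩, fun ε hε => ?_⟩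
  · by_contra hne
    -- Take `ε` to be the capacity of the divergence set itself: that set lies in `G`, whose
    -- capacity is strictly smaller.
    obtain ⟨G, -, -, hGε, hunif⟩ := key _ (pos_iff_ne_zero.2 hne)
    refine absurd (FracVarExp.relCap_mono fun x hx => ?_) (not_le.2 hGε)
    by_contra hxG
    exact hx.2 (hunif.tendsto_at ⟨hx.1, hxG⟩)
  · by_contra hlim
    exact hx.2 ⟨hx.1, hlim⟩
  · obtain ⟨G, -, hGΩ, hGε, hunif⟩ := key ε hε
    exact ⟨G, hGΩ, hGε, hunif⟩
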